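/- **Setting.** Let $G$ be a finite-dimensional real Lie group with identity $e$ and Lie algebra $\mathfrak g=T_eG$ (bracket of left-invariant vector fields), written as a direct sum of linear subspaces $\mathfrak g=\mathfrak k\oplus\mathfrak p$, and let $e_0\in\mathfrak p$. Write $\mathrm{pr}_{\mathfrak k},\mathrm{pr}_{\mathfrak p}$ for the projections, and regard $\mathfrak k^*,\mathfrak p^*$ as subspaces of $\mathfrak g^*=\mathfrak k^*\oplus\mathfrak p^*$ through them. Let $X$ be a finite-dimensional real vector space, $\rho:G\to\mathrm{GL}(X)$ a smooth representation, $\rho'_\xi$ ($\xi\in\mathfrak g$) the induced representation of $\mathfrak g$, and $\rho^*_g(\alpha)=\alpha\circ\rho_g$, $\rho'^*_\xi(\alpha)=\alpha\circ\rho'_\xi$ for $\alpha\in X^*$. Let $C:G\times\mathfrak k\to\mathbb R$ be $C^1$ with $C(gh,w)=C(h,w)$, let $V_{\rm ext}:G\times X^*\to\mathbb R$ be $C^1$ with $V_{\rm ext}(gh,\rho^*_{g^{-1}}\alpha)=V_{\rm ext}(h,\alpha)$, and let $\alpha_0\in X^*$, $V=V_{\rm ext}(\cdot,\alpha_0)$.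 Fix $T>0$ and $g_0,g_T\in G$ and consider the problem $$\textbf{(P1)}\quad \min\int_0^T\big[C(g,u-e_0)+V(g)\big]dt,\qquad \dot g=T_eL_g(u),\quad u(t)\in e_0+\mathfrak k,\quad g(0)=g_0,\ g(T)=g_T .$$ **Normal extremals.** Put $L_a(g,u,\lambda,\alpha)=C(g,\mathrm{pr}_{\mathfrak k}(u-e_0))+V_{\rm ext}(g,\alpha)+\langle\lambda,\mathrm{pr}_{\mathfrak p}(u-e_0)\rangle$ for $g\in G$, $u\in\mathfrak g$, $\lambda\in\mathfrak p^*$, $\alpha\in X^*$. A normal extremal of (P1) is a triple $(g,u,\lambda)$ with $g\in C^1([0,T],G)$ and $u$ satisfying the constraints of (P1) and $\lambda\in C^1([0,T],\mathfrak p^*)$, such that $$\frac{d}{d\varepsilon}\Big|_{\varepsilon=0}\int_0^T L_a\big(g_\varepsilon(t),u_\varepsilon(t),\lambda(t),\alpha_0\big)\,dt=0$$ for every $C^1$ variation $(\varepsilon,t)\mapsto g_\varepsilon(t)$ of $g_{\varepsilon=0}=g$ ($|\varepsilon|<\delta$) with the fixed endpoints $g(0)$ and $g(T)$, where the induced variation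 $u_\varepsilon=T L_{g_\varepsilon^{-1}}(\partial_t g_\varepsilon)\in\mathfrak g$ is continuous, and continuously differentiable in $\varepsilon$, jointly in $(\varepsilon,t)$. **Theorem 4.** Let $(g,u,\lambda)$ be a normal extremal of (P1) and put $\alpha(t)=\rho^*_{g(t)}(\alpha_0)$. Then $\frac{\partial C}{\partial u}+\lambda:[0,T]\to\mathfrak g^*$ and $\alpha$ are differentiable and satisfy on $[0,T]$ the Euler–Poincaré equations $$\frac{d}{dt}\Big(\frac{\partial C}{\partial u}+\lambda\Big)=\mathrm{ad}^*_u\Big(\frac{\partial C}{\partial u}+\lambda\Big)+\mathbf J_X\Big(\frac{\partial V_{\rm ext}}{\partial\alpha},\alpha\Big),$$ $$\dot\alpha=\rho'^*_u(\alpha),\qquad \alpha(0)=\rho^*_{g_0}(\alpha_0).$$ Here $\frac{\partial C}{\partial u}\in\mathfrak k^*\subset\mathfrak g^*$ is the derivative of $w\mapsto C(e,w)$ at $w=u-e_0\in\mathfrak k$, $\frac{\partial V_{\rm ext}}{\partial\alpha}\in X^{**}\cong X$ is the derivative of $V_{\rm ext}(e,\cdot)$ at $\alpha$, $\langle\mathrm{ad}^*_\xi\mu,\eta\rangle=\langle\mu,[\xi,\eta]\rangle$,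 and $\langle\mathbf J_X(x,\alpha),\xi\rangle=\langle\alpha,\rho'_\xi x\rangle$. -/

import Mathlib

open Set MeasureTheory
open scoped Manifold ContDiff

/-- A smooth Lie group has enough regularity for Mathlib's Lie algebra structure on its tangent
space at the identity. -/
instance instLEInftyMinSmoothnessThree : ENat.LEInfty (minSmoothness ℝ 3) :=
  ⟨by rw [minSmoothness_of_isRCLikeNormedField]; exact ENat.LEInfty.out⟩

noncomputable section

namespace BrokenSymmetryOCP

/-! Throughout, `G` is a real finite-dimensional Lie group modelled on `E` through `I`. Its Lie
algebra `𝔤 = T_e G` is `GroupLieAlgebra I G`, whose underlying vector space is the model space `E`;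
elements of `𝔤` are written as elements of `E`, and `𝔤*` is `StrongDual ℝ E`. -/

section LieTheory

variable {E : Type*} [NormedAddCommGroup E] [NormedSpace ℝ E] [FiniteDimensional ℝ E]
  {H : Type*} [TopologicalSpace H] (I : ModelWithCorners ℝ E H)
  (G : Type*) [TopologicalSpace G] [ChartedSpace H G] [Group G] [LieGroup I ∞ G]

/-- `ad_ξ : 𝔤 → 𝔤`, `ad_ξ η = [ξ, η]`, for the bracket of left-invariant vector fields. -/
def ad (ξ : E) : E →L[ℝ] E :=
  haveI : CompleteSpace E := FiniteDimensional.complete ℝ E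
  LinearMap.toContinuousLinearMap (E := E) (F' := E)
    (LieAlgebra.ad ℝ (GroupLieAlgebra I G) (ξ : GroupLieAlgebra I G))

/-- `ad*_ξ : 𝔤* → 𝔤*`, `⟨ad*_ξ μ, η⟩ = ⟨μ, [ξ, η]⟩`. -/
def adStar (ξ : E) (μ : StrongDual ℝ E) : StrongDual ℝ E :=
  μ.comp (ad I G ξ)

end LieTheory

section Curves

variable {E : Type*} [NormedAddCommGroup E] [NormedSpace ℝ E]
  {H : Type*} [TopologicalSpace H] (I : ModelWithCorners ℝ E H)
  {G : Type*} [TopologicalSpace G] [ChartedSpace H G] [Group G]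

/-- `ġ(t) = T_e L_{g(t)} (u(t))` for every `t ∈ [0,T]` (one-sided derivatives at the endpoints). -/
def HasLeftVelocity (T : ℝ) (g : ℝ → G) (u : ℝ → E) : Prop :=
  ∀ t ∈ Icc 0 T, HasMFDerivWithinAt 𝓘(ℝ, ℝ) I g (Icc 0 T) t
    ((1 : ℝ →L[ℝ] ℝ).smulRight
      (mulInvariantVectorField (I := I) (u t : GroupLieAlgebra I G) (g t)))

/-- A variation of the curve `g : [0,T] → G` with fixed endpoints: a `C¹` family
`Γ ε : [0,T] → G`, `|ε| < δ`, with `Γ 0 = g`, such that the curves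
`ξ ε t = T L_{Γ ε t}⁻¹ (∂Γ/∂t)` in `𝔤` (the induced variation of the control) are continuous
and continuously differentiable with respect to `ε`, jointly in `(ε, t)`. -/
structure IsVariation (T δ : ℝ) (g : ℝ → G) (Γ : ℝ → ℝ → G) (ξ : ℝ → ℝ → E) : Prop where
  base : ∀ t ∈ Icc 0 T, Γ 0 t = g t
  left_end : ∀ ε ∈ Ioo (-δ) δ, Γ ε 0 = g 0
  right_end : ∀ ε ∈ Ioo (-δ) δ, Γ ε T = g T
  contMDiffOn : ContMDiffOn 𝓘(ℝ, ℝ × ℝ) I 1 (fun q : ℝ × ℝ => Γ q.1 q.2)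
    (Ioo (-δ) δ ×ˢ Icc 0 T)
  velocity : ∀ ε ∈ Ioo (-δ) δ, HasLeftVelocity I T (Γ ε) (ξ ε)
  continuousOn : ContinuousOn (fun q : ℝ × ℝ => ξ q.1 q.2) (Ioo (-δ) δ ×ˢ Icc 0 T)
  differentiableAt : ∀ ε ∈ Ioo (-δ) δ, ∀ t ∈ Icc 0 T, DifferentiableAt ℝ (fun s => ξ s t) ε
  continuousOn_deriv : ContinuousOn (fun q : ℝ × ℝ => deriv (fun s => ξ s q.2) q.1)
    (Ioo (-δ) δ ×ˢ Icc 0 T)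

end Curves

section Representation

variable {E : Type*} [NormedAddCommGroup E] [NormedSpace ℝ E]
  {H : Type*} [TopologicalSpace H] (I : ModelWithCorners ℝ E H)
  {G : Type*} [TopologicalSpace G] [ChartedSpace H G] [Group G]
  {X : Type*} [NormedAddCommGroup X] [NormedSpace ℝ X]

/-- `ρ*_g : X* → X*`, the adjoint of `ρ_g`. -/
def rhoStar (ρ : G →* (X →L[ℝ] X)) (g : G) (α : StrongDual ℝ X) : StrongDual ℝ X :=
  α.comp (ρ g)

/-- The induced representation `ρ' : 𝔤 → 𝔤𝔩(X)`, the derivative of `ρ` at the identity. -/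
def rhoPrime (ρ : G →* (X →L[ℝ] X)) : E →L[ℝ] (X →L[ℝ] X) :=
  mfderiv I 𝓘(ℝ, X →L[ℝ] X) (fun g => ρ g) 1

/-- `ρ'*_ξ : X* → X*`, the adjoint of `ρ'_ξ`. -/
def rhoPrimeStar (ρ : G →* (X →L[ℝ] X)) (ξ : E) (α : StrongDual ℝ X) : StrongDual ℝ X :=
  α.comp (rhoPrime I ρ ξ)

/-- The momentum map `J_X : X × X* → 𝔤*`, `⟨J_X(x, α), ξ⟩ = ⟨α, ξ_X(x)⟩`, where `ξ_X(x) = ρ'_ξ x`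
is the infinitesimal generator of the linear action of `G` on `X`. -/
def momentumMap (ρ : G →* (X →L[ℝ] X)) (x : X) (α : StrongDual ℝ X) : StrongDual ℝ E :=
  α.comp ((rhoPrime I ρ).flip x)

/-- The derivative at `α` of a function on `X*`, as an element of `X ≅ X**`. -/
def dualGradient [FiniteDimensional ℝ X] (f : StrongDual ℝ X → ℝ) (α : StrongDual ℝ X) : X :=
  (Module.evalEquiv ℝ X).symm
    ((fderiv ℝ f α : StrongDual ℝ X →ₗ[ℝ] ℝ) ∘ₗ
      (LinearMap.toContinuousLinearMap : (X →ₗ[ℝ] ℝ) ≃ₗ[ℝ] StrongDual ℝ X).toLinearMap)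

/-- The defining property of `dualGradient`. -/
theorem apply_dualGradient [FiniteDimensional ℝ X] (f : StrongDual ℝ X → ℝ)
    (α β : StrongDual ℝ X) : β (dualGradient f α) = fderiv ℝ f α β := by
  have h := Module.apply_evalEquiv_symm_apply (R := ℝ) (M := X) (β : X →ₗ[ℝ] ℝ)
    ((fderiv ℝ f α : StrongDual ℝ X →ₗ[ℝ] ℝ) ∘ₗ
      (LinearMap.toContinuousLinearMap : (X →ₗ[ℝ] ℝ) ≃ₗ[ℝ] StrongDual ℝ X).toLinearMap)
  exact h

end Representation

/-- The data of the optimal control problem: minimize `∫₀ᵀ [C(g, u - e₀) + V(g)] dt` subject to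
`ġ = T_e L_g (u)`, `u - e₀ ∈ 𝔨`, `g(0) = g₀`, `g(T) = g_T`, where `V = V_ext(·, α₀)`. -/
structure Problem {E : Type*} [NormedAddCommGroup E] [NormedSpace ℝ E]
    {H : Type*} [TopologicalSpace H] (I : ModelWithCorners ℝ E H)
    (G : Type*) [TopologicalSpace G] [ChartedSpace H G] [Group G]
    (X : Type*) [NormedAddCommGroup X] [NormedSpace ℝ X] where
  /-- the final time -/
  T : ℝ
  T_pos : 0 < T
  /-- the prescribed endpoints -/
  g₀ : G
  gT : G
  /-- the control directions `𝔨` and the complementary directions `𝔭` in the Lie algebra -/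
  𝔨 : Submodule ℝ E
  𝔭 : Submodule ℝ E
  isCompl : IsCompl 𝔨 𝔭
  /-- the drift -/
  e₀ : E
  e₀_mem : e₀ ∈ 𝔭
  /-- the control cost, invariant under `g • (h, w) = (g * h, w)` -/
  C : G × 𝔨 → ℝ
  C_contMDiff : ContMDiff (I.prod 𝓘(ℝ, 𝔨)) 𝓘(ℝ, ℝ) 1 C
  C_invariant : ∀ (g h : G) (w : 𝔨), C (g * h, w) = C (h, w)
  /-- the representation of `G` on `X` -/
  ρ : G →* (X →L[ℝ] X)
  ρ_contMDiff : ContMDiff I 𝓘(ℝ, X →L[ℝ] X) ∞ (fun g => ρ g)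
  /-- the extended potential, invariant under `g • (h, α) = (g * h, ρ*_{g⁻¹} α)` -/
  Vext : G × StrongDual ℝ X → ℝ
  Vext_contMDiff : ContMDiff (I.prod 𝓘(ℝ, StrongDual ℝ X)) 𝓘(ℝ, ℝ) 1 Vext
  Vext_invariant : ∀ (g h : G) (α : StrongDual ℝ X),
    Vext (g * h, rhoStar ρ g⁻¹ α) = Vext (h, α)
  /-- the value of the parameter that gives the potential -/
  α₀ : StrongDual ℝ X

namespace Problem

variable {E : Type*} [NormedAddCommGroup E] [NormedSpace ℝ E] [FiniteDimensional ℝ E]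
  {H : Type*} [TopologicalSpace H] {I : ModelWithCorners ℝ E H}
  {G : Type*} [TopologicalSpace G] [ChartedSpace H G] [Group G]
  {X : Type*} [NormedAddCommGroup X] [NormedSpace ℝ X]
  (P : Problem I G X)

/-- The projection of `𝔤 = 𝔨 ⊕ 𝔭` onto `𝔨`. -/
def projK : E →L[ℝ] P.𝔨 :=
  LinearMap.toContinuousLinearMap (P.𝔨.projectionOnto P.𝔭 P.isCompl)

/-- The projection of `𝔤 = 𝔨 ⊕ 𝔭` onto `𝔭`. -/
def projP : E →L[ℝ] P.𝔭 :=
  LinearMap.toContinuousLinearMap (P.𝔭.projectionOnto P.𝔨 P.isCompl.symm)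

/-- The inclusion `𝔭* ⊆ 𝔤* = 𝔨* ⊕ 𝔭*`. -/
def inclP (l : StrongDual ℝ P.𝔭) : StrongDual ℝ E :=
  l.comp P.projP

/-- The augmented Lagrangian `L_a(g, u, λ, α) = C(g, u - e₀) + V_ext(g, α) + ⟨λ, u - e₀⟩`.
Velocities `u` of varied curves are arbitrary elements of `𝔤 = 𝔨 ⊕ 𝔭`; the cost sees
the `𝔨`-component of `u - e₀` and the multiplier its `𝔭`-component. -/
def augLagrangian (g : G) (u : E) (l : StrongDual ℝ P.𝔭) (α : StrongDual ℝ X) : ℝ :=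
  P.C (g, P.projK (u - P.e₀)) + P.Vext (g, α) + P.inclP l (u - P.e₀)

/-- `(g, u, λ)` is a normal extremal: `(g, u)` satisfies the constraints of the problem, `λ` is a
`C¹` curve in `𝔭*`, and the action of the augmented Lagrangian (with cost multiplier `1`) is
stationary under all variations of `g` with fixed endpoints. -/
structure IsNormalExtremal (g : ℝ → G) (u : ℝ → E) (l : ℝ → StrongDual ℝ P.𝔭) : Prop where
  contMDiffOn : ContMDiffOn 𝓘(ℝ, ℝ) I 1 g (Icc 0 P.T)
  velocity : HasLeftVelocity I P.T g u
  left_end : g 0 = P.g₀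
  right_end : g P.T = P.gT
  control : ∀ t ∈ Icc 0 P.T, u t - P.e₀ ∈ P.𝔨
  multiplier : ContDiffOn ℝ 1 l (Icc 0 P.T)
  stationary : ∀ (δ : ℝ) (Γ : ℝ → ℝ → G) (ξ : ℝ → ℝ → E), 0 < δ →
    IsVariation I P.T δ g Γ ξ →
    HasDerivAt (fun ε => ∫ t in (0 : ℝ)..P.T, P.augLagrangian (Γ ε t) (ξ ε t) (l t) P.α₀) 0 0

/-- `∂C/∂u ∈ 𝔨* ⊆ 𝔤*` at `u`, for the reduced cost `u ↦ C(e, u - e₀)`. -/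
def dCost (u : E) : StrongDual ℝ E :=
  (fderiv ℝ (fun w : P.𝔨 => P.C (1, w)) (P.projK (u - P.e₀))).comp P.projK

/-- `∂V_ext/∂α ∈ X** ≅ X` at `α`, for the reduced potential `α ↦ V_ext(e, α)`. -/
def dPotential [FiniteDimensional ℝ X] (α : StrongDual ℝ X) : X :=
  dualGradient (fun β => P.Vext (1, β)) α

/-- The advected parameter `α(t) = ρ*_{g(t)}(α₀)`. -/
def advected (g : ℝ → G) (t : ℝ) : StrongDual ℝ X :=
  rhoStar P.ρ (g t) P.α₀

/-- `∂C/∂u + λ ∈ 𝔤*` along a curve. -/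
def momentum (u : ℝ → E) (l : ℝ → StrongDual ℝ P.𝔭) (t : ℝ) : StrongDual ℝ E :=
  P.dCost (u t) + P.inclP (l t)

end Problem

end BrokenSymmetryOCP

end

namespace BrokenSymmetryOCP

open Filter Topology


section ChartAtIdentity

variable {E : Type*} [NormedAddCommGroup E] [NormedSpace ℝ E]
  {H : Type*} [TopologicalSpace H] (I : ModelWithCorners ℝ E H)
  (G : Type*) [TopologicalSpace G] [ChartedSpace H G] [Group G]

/-- The coordinates of the identity in its preferred chart. -/
noncomputable def chartOne : E := extChartAt I (1 : G) 1

/-- The multiplication of `G` read in the preferred chart at the identity. -/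
noncomputable def chartMul (p : E × E) : E :=
  extChartAt I (1 : G) ((extChartAt I (1 : G)).symm p.1 * (extChartAt I (1 : G)).symm p.2)

/-- The differential at the identity of the left translation by the element with coordinates `x`,
read in the preferred chart at the identity. -/
noncomputable def leftFrame (x : E) : E →L[ℝ] E :=
  (fderiv ℝ (chartMul I G) (x, chartOne I G)).comp (ContinuousLinearMap.inr ℝ E E)

/-- The differential at the identity of the right translation by the element with coordinates `x`,
read in the preferred chart at the identity. -/
noncomputable def rightFrame (x : E) : E →L[ℝ] E :=
  (fderiv ℝ (chartMul I G) (chartOne I G, x)).comp (ContinuousLinearMap.inl ℝ E E)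

variable {I G}

theorem chartOne_mem_target : chartOne I G ∈ (extChartAt I (1 : G)).target :=
  mem_extChartAt_target 1

theorem extChartAt_symm_chartOne : (extChartAt I (1 : G)).symm (chartOne I G) = 1 :=
  extChartAt_to_inv 1

theorem chartMul_chartOne_left {x : E} (hx : x ∈ (extChartAt I (1 : G)).target) :
    chartMul I G (chartOne I G, x) = x := by
  simp only [chartMul, extChartAt_symm_chartOne, one_mul]
  exact (extChartAt I (1 : G)).right_inv hx

theorem chartMul_chartOne_right {x : E} (hx : x ∈ (extChartAt I (1 : G)).target) :
    chartMul I G (x, chartOne I G) = x := by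
  simp only [chartMul, extChartAt_symm_chartOne, mul_one]
  exact (extChartAt I (1 : G)).right_inv hx

variable [I.Boundaryless]

theorem extChartAt_target_mem_nhds_of_mem {x : E} (hx : x ∈ (extChartAt I (1 : G)).target) :
    (extChartAt I (1 : G)).target ∈ 𝓝 x :=
  (isOpen_extChartAt_target (1 : G)).mem_nhds hx

variable [LieGroup I ∞ G]

theorem contMDiffAt_extChartAt_symm {x : E} (hx : x ∈ (extChartAt I (1 : G)).target) :
    ContMDiffAt 𝓘(ℝ, E) I ∞ (extChartAt I (1 : G)).symm x :=
  (contMDiffOn_extChartAt_symm (1 : G)).contMDiffAt (extChartAt_target_mem_nhds_of_mem hx)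

theorem hasMFDerivAt_extChartAt_symm {x : E} (hx : x ∈ (extChartAt I (1 : G)).target) :
    HasMFDerivAt 𝓘(ℝ, E) I (extChartAt I (1 : G)).symm x
      (mfderiv 𝓘(ℝ, E) I (extChartAt I (1 : G)).symm x) :=
  ((contMDiffAt_extChartAt_symm hx).mdifferentiableAt (by simp)).hasMFDerivAt

theorem contDiffAt_chartMul {p : E × E} (h1 : p.1 ∈ (extChartAt I (1 : G)).target)
    (h2 : p.2 ∈ (extChartAt I (1 : G)).target)
    (h : (extChartAt I (1 : G)).symm p.1 * (extChartAt I (1 : G)).symm p.2 ∈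
      (extChartAt I (1 : G)).source) :
    ContDiffAt ℝ ∞ (chartMul I G) p := by
  rw [← contMDiffAt_iff_contDiffAt]
  have hm : ContMDiffAt 𝓘(ℝ, E × E) I ∞ (fun p : E × E =>
      (extChartAt I (1 : G)).symm p.1 * (extChartAt I (1 : G)).symm p.2) p := by
    have a : ContMDiffAt 𝓘(ℝ, E × E) I ∞
        (fun p : E × E => (extChartAt I (1 : G)).symm p.1) p :=
      (contMDiffAt_extChartAt_symm h1).comp p contDiff_fst.contMDiff.contMDiffAt
    have b : ContMDiffAt 𝓘(ℝ, E × E) I ∞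
        (fun p : E × E => (extChartAt I (1 : G)).symm p.2) p :=
      (contMDiffAt_extChartAt_symm h2).comp p contDiff_snd.contMDiff.contMDiffAt
    exact a.mul b
  rw [extChartAt_source] at h
  exact (contMDiffAt_extChartAt' h).comp p hm

theorem contDiffAt_chartMul_chartOne_right {x : E} (hx : x ∈ (extChartAt I (1 : G)).target) :
    ContDiffAt ℝ ∞ (chartMul I G) (x, chartOne I G) :=
  contDiffAt_chartMul hx chartOne_mem_target (by
    rw [extChartAt_symm_chartOne, mul_one]
    exact (extChartAt I (1 : G)).map_target hx)

theorem contDiffAt_chartMul_chartOne_left {x : E} (hx : x ∈ (extChartAt I (1 : G)).target) :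
    ContDiffAt ℝ ∞ (chartMul I G) (chartOne I G, x) :=
  contDiffAt_chartMul chartOne_mem_target hx (by
    rw [extChartAt_symm_chartOne, one_mul]
    exact (extChartAt I (1 : G)).map_target hx)

theorem hasFDerivAt_chartMul_chartOne_right {x : E}
    (hx : x ∈ (extChartAt I (1 : G)).target) :
    HasFDerivAt (chartMul I G) (fderiv ℝ (chartMul I G) (x, chartOne I G)) (x, chartOne I G) :=
  ((contDiffAt_chartMul_chartOne_right hx).differentiableAt (by simp)).hasFDerivAt

theorem hasFDerivAt_chartMul_chartOne_left {x : E}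
    (hx : x ∈ (extChartAt I (1 : G)).target) :
    HasFDerivAt (chartMul I G) (fderiv ℝ (chartMul I G) (chartOne I G, x)) (chartOne I G, x) :=
  ((contDiffAt_chartMul_chartOne_left hx).differentiableAt (by simp)).hasFDerivAt

theorem contDiffAt_leftFrame {x : E} (hx : x ∈ (extChartAt I (1 : G)).target) :
    ContDiffAt ℝ ∞ (leftFrame I G) x := by
  have h : ContDiffAt ℝ ∞ (fun x : E => fderiv ℝ (chartMul I G) (x, chartOne I G)) x :=
    ContDiffAt.comp x ((contDiffAt_chartMul_chartOne_right hx).fderiv_right (m := ∞) (by simp))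
      (contDiffAt_id.prodMk contDiffAt_const)
  exact h.clm_comp contDiffAt_const

theorem contDiffAt_rightFrame {x : E} (hx : x ∈ (extChartAt I (1 : G)).target) :
    ContDiffAt ℝ ∞ (rightFrame I G) x := by
  have h : ContDiffAt ℝ ∞ (fun x : E => fderiv ℝ (chartMul I G) (chartOne I G, x)) x :=
    ContDiffAt.comp x ((contDiffAt_chartMul_chartOne_left hx).fderiv_right (m := ∞) (by simp))
      (contDiffAt_const.prodMk contDiffAt_id)
  exact h.clm_comp contDiffAt_const

theorem fderiv_chartMul_comp_inr {x : E} (hx : x ∈ (extChartAt I (1 : G)).target) :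
    (fderiv ℝ (chartMul I G) (chartOne I G, x)).comp (ContinuousLinearMap.inr ℝ E E) =
      ContinuousLinearMap.id ℝ E := by
  have h := (hasFDerivAt_chartMul_chartOne_left hx).comp x (hasFDerivAt_prodMk_right _ x)
  refine h.unique ((hasFDerivAt_id x).congr_of_eventuallyEq ?_)
  filter_upwards [extChartAt_target_mem_nhds_of_mem hx] with y hy
  exact chartMul_chartOne_left hy

theorem fderiv_chartMul_comp_inl {x : E} (hx : x ∈ (extChartAt I (1 : G)).target) :
    (fderiv ℝ (chartMul I G) (x, chartOne I G)).comp (ContinuousLinearMap.inl ℝ E E) =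
      ContinuousLinearMap.id ℝ E := by
  have h := HasFDerivAt.comp x (f := fun y : E => (y, chartOne I G))
    (hasFDerivAt_chartMul_chartOne_right hx) (hasFDerivAt_prodMk_left x _)
  refine h.unique ((hasFDerivAt_id x).congr_of_eventuallyEq ?_)
  filter_upwards [extChartAt_target_mem_nhds_of_mem hx] with y hy
  exact chartMul_chartOne_right hy

theorem leftFrame_chartOne : leftFrame I G (chartOne I G) = ContinuousLinearMap.id ℝ E :=
  fderiv_chartMul_comp_inr chartOne_mem_target

theorem rightFrame_chartOne : rightFrame I G (chartOne I G) = ContinuousLinearMap.id ℝ E :=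
  fderiv_chartMul_comp_inl chartOne_mem_target

theorem fderiv_leftFrame_apply (v w : E) :
    fderiv ℝ (leftFrame I G) (chartOne I G) v w =
      fderiv ℝ (fderiv ℝ (chartMul I G)) (chartOne I G, chartOne I G) (v, 0) (0, w) := by
  have h2 : HasFDerivAt (fderiv ℝ (chartMul I G))
      (fderiv ℝ (fderiv ℝ (chartMul I G)) (chartOne I G, chartOne I G))
      (chartOne I G, chartOne I G) :=
    (((contDiffAt_chartMul_chartOne_right chartOne_mem_target).fderiv_right
      (m := ∞) (by simp)).differentiableAt (by simp)).hasFDerivAt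
  have h3 := HasFDerivAt.comp (chartOne I G) (f := fun y : E => (y, chartOne I G)) h2
    (hasFDerivAt_prodMk_left (chartOne I G) (chartOne I G))
  have h4 := h3.clm_comp (hasFDerivAt_const (ContinuousLinearMap.inr ℝ E E) (chartOne I G))
  have h5 : HasFDerivAt (leftFrame I G) _ (chartOne I G) := h4
  rw [h5.fderiv]
  simp

theorem fderiv_rightFrame_apply (v w : E) :
    fderiv ℝ (rightFrame I G) (chartOne I G) v w =
      fderiv ℝ (fderiv ℝ (chartMul I G)) (chartOne I G, chartOne I G) (0, v) (w, 0) := by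
  have h2 : HasFDerivAt (fderiv ℝ (chartMul I G))
      (fderiv ℝ (fderiv ℝ (chartMul I G)) (chartOne I G, chartOne I G))
      (chartOne I G, chartOne I G) :=
    (((contDiffAt_chartMul_chartOne_right chartOne_mem_target).fderiv_right
      (m := ∞) (by simp)).differentiableAt (by simp)).hasFDerivAt
  have h3 := h2.comp (chartOne I G) (hasFDerivAt_prodMk_right (chartOne I G) (chartOne I G))
  have h4 := h3.clm_comp (hasFDerivAt_const (ContinuousLinearMap.inl ℝ E E) (chartOne I G))
  have h5 : HasFDerivAt (rightFrame I G) _ (chartOne I G) := h4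
  rw [h5.fderiv]
  simp

theorem fderiv_rightFrame_eq (v w : E) :
    fderiv ℝ (rightFrame I G) (chartOne I G) v w =
      fderiv ℝ (leftFrame I G) (chartOne I G) w v := by
  rw [fderiv_rightFrame_apply, fderiv_leftFrame_apply]
  have h : IsSymmSndFDerivAt ℝ (chartMul I G) (chartOne I G, chartOne I G) :=
    (contDiffAt_chartMul_chartOne_right chartOne_mem_target).isSymmSndFDerivAt
      (by simpa using WithTop.coe_le_coe.2 (le_top : (2 : ℕ∞) ≤ ⊤))
  exact h _ _

theorem mulInvariantVectorField_extChartAt_symm {x : E}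
    (hx : x ∈ (extChartAt I (1 : G)).target) (v : E) :
    mulInvariantVectorField (I := I) (v : GroupLieAlgebra I G) ((extChartAt I (1 : G)).symm x) =
      mfderiv 𝓘(ℝ, E) I (extChartAt I (1 : G)).symm x (leftFrame I G x v) := by
  have : IsManifold I 1 G := IsManifold.of_le (n := ∞) (by simp)
  have hφ : HasMFDerivAt I 𝓘(ℝ, E) (extChartAt I (1 : G)) 1
      (ContinuousLinearMap.id ℝ (TangentSpace I (1 : G))) := by
    have := (mdifferentiableAt_extChartAt (I := I) (x := (1 : G)) (y := 1)
      (mem_chart_source H 1)).hasMFDerivAt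
    rwa [mfderiv_extChartAt_self] at this
  have hF' : HasFDerivAt (fun y => chartMul I G (x, y)) (leftFrame I G x) (chartOne I G) :=
    (hasFDerivAt_chartMul_chartOne_right hx).comp (chartOne I G)
      (hasFDerivAt_prodMk_right x (chartOne I G))
  have hF := hF'.hasMFDerivAt
  have hs := hasMFDerivAt_extChartAt_symm hx
  rw [← chartMul_chartOne_right hx] at hs
  have h := hs.comp (chartOne I G) hF
  have h' := HasMFDerivAt.comp (1 : G) h hφ
  have heq : (fun h : G => (extChartAt I (1 : G)).symm x * h) =ᶠ[𝓝 1]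
      ((extChartAt I (1 : G)).symm ∘ (fun y => chartMul I G (x, y))) ∘ extChartAt I (1 : G) := by
    have hc : ContinuousAt (fun h : G => (extChartAt I (1 : G)).symm x * h) 1 :=
      (contMDiff_mul_left (I := I) (n := ∞)).continuous.continuousAt
    have hn : (extChartAt I (1 : G)).source ∈ 𝓝 ((extChartAt I (1 : G)).symm x * 1) := by
      rw [mul_one]
      exact (isOpen_extChartAt_source (1 : G)).mem_nhds ((extChartAt I (1 : G)).map_target hx)
    filter_upwards [hc.preimage_mem_nhds hn, extChartAt_source_mem_nhds (I := I) (1 : G)]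
      with k hk hk1
    simp only [Function.comp_apply, chartMul, (extChartAt I (1 : G)).left_inv hk1]
    exact ((extChartAt I (1 : G)).left_inv hk).symm
  have := h'.congr_of_eventuallyEq heq
  have e := this.mfderiv
  rw [chartMul_chartOne_right hx] at e
  exact congrArg (fun L => L v) e

theorem eventually_isInvertible_leftFrame [CompleteSpace E] :
    ∀ᶠ x in 𝓝 (chartOne I G), (leftFrame I G x).IsInvertible := by
  have h := (contDiffAt_leftFrame (I := I) (G := G) chartOne_mem_target).continuousAt
  have hn : range ((↑) : (E ≃L[ℝ] E) → E →L[ℝ] E) ∈ 𝓝 (leftFrame I G (chartOne I G)) := by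
    rw [leftFrame_chartOne]
    exact ContinuousLinearEquiv.nhds (ContinuousLinearEquiv.refl ℝ E)
  filter_upwards [h.preimage_mem_nhds hn] with x hx
  exact hx

theorem mpullbackWithin_mulInvariantVectorField {x : E}
    (hx : x ∈ (extChartAt I (1 : G)).target) (v : E) :
    VectorField.mpullbackWithin 𝓘(ℝ, E) I (extChartAt I (1 : G)).symm
      (mulInvariantVectorField (I := I) (v : GroupLieAlgebra I G)) (range I) x =
      leftFrame I G x v := by
  have : IsManifold I 1 G := IsManifold.of_le (n := ∞) (by simp)
  rw [VectorField.mpullbackWithin_apply, mulInvariantVectorField_extChartAt_symm hx]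
  have hinv := isInvertible_mfderivWithin_extChartAt_symm (I := I) hx
  rw [I.range_eq_univ, mfderivWithin_univ] at hinv ⊢
  exact hinv.inverse_apply_eq.2 rfl

theorem ad_apply [FiniteDimensional ℝ E] (v w : E) :
    ad I G v w = fderiv ℝ (leftFrame I G) (chartOne I G) v w -
      fderiv ℝ (leftFrame I G) (chartOne I G) w v := by
  have : IsManifold I 1 G := IsManifold.of_le (n := ∞) (by simp)
  have hfield (a : E) : VectorField.mpullbackWithin 𝓘(ℝ, E) I (extChartAt I (1 : G)).symm
      (mulInvariantVectorField (I := I) (a : GroupLieAlgebra I G)) (range I) =ᶠ[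
        𝓝 (chartOne I G)] fun x => leftFrame I G x a := by
    filter_upwards [extChartAt_target_mem_nhds_of_mem chartOne_mem_target] with x hx
    exact mpullbackWithin_mulInvariantVectorField hx a
  have hd (a : E) : HasFDerivAt (fun x => leftFrame I G x a)
      ((fderiv ℝ (leftFrame I G) (chartOne I G)).flip a) (chartOne I G) := by
    have h := ((contDiffAt_leftFrame (I := I) (G := G)
      chartOne_mem_target).differentiableAt (by simp)).hasFDerivAt
    convert! h.clm_apply (hasFDerivAt_const a (chartOne I G)) using 1
    ext b
    simp
  have key (z : E) :
      (mfderiv I 𝓘(ℝ, E) (extChartAt I (1 : G)) 1).inverse z = z := by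
    rw [mfderiv_extChartAt_self]
    exact congrArg (fun L : E →L[ℝ] E => L z) ContinuousLinearMap.inverse_id
  have hb : ad I G v w = VectorField.lieBracketWithin ℝ
      (VectorField.mpullbackWithin 𝓘(ℝ, E) I (extChartAt I (1 : G)).symm
        (mulInvariantVectorField (I := I) (G := G) (v : GroupLieAlgebra I G)) (range I))
      (VectorField.mpullbackWithin 𝓘(ℝ, E) I (extChartAt I (1 : G)).symm
        (mulInvariantVectorField (I := I) (G := G) (w : GroupLieAlgebra I G)) (range I))
      univ (chartOne I G) := by
    have hset : (extChartAt I (1 : G)).symm ⁻¹' univ ∩ range I = univ := by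
      rw [preimage_univ, univ_inter, I.range_eq_univ]
    rw [← hset]
    exact key _
  rw [hb]
  refine (congrFun (VectorField.lieBracketWithin_univ ..) _).trans ?_
  refine ((hfield v).lieBracket_vectorField_eq (hfield w)).trans ?_
  rw [VectorField.lieBracket, (hd v).fderiv, (hd w).fderiv]
  simp [leftFrame_chartOne]

end ChartAtIdentity

section LeftVelocity

theorem smulRight_one_eq_toSpanSingleton {F : Type*} [NormedAddCommGroup F] [NormedSpace ℝ F]
    (x : F) : (1 : ℝ →L[ℝ] ℝ).smulRight x = ContinuousLinearMap.toSpanSingleton ℝ x := by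
  ext
  simp

theorem comp_smulRight_one {E F : Type*} [NormedAddCommGroup E] [NormedSpace ℝ E]
    [NormedAddCommGroup F] [NormedSpace ℝ F] (L : E →L[ℝ] F) (x : E) :
    L.comp ((1 : ℝ →L[ℝ] ℝ).smulRight x) = (1 : ℝ →L[ℝ] ℝ).smulRight (L x) := by
  ext
  simp

variable {E : Type*} [NormedAddCommGroup E] [NormedSpace ℝ E]
  {H : Type*} [TopologicalSpace H] (I : ModelWithCorners ℝ E H)
  {G : Type*} [TopologicalSpace G] [ChartedSpace H G] [Group G]

/-- The curve `g` has left-trivialized velocity `u` at `t` within `s`. -/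
def HasLeftVelocityWithinAt (g : ℝ → G) (u : E) (s : Set ℝ) (t : ℝ) : Prop :=
  HasMFDerivWithinAt 𝓘(ℝ, ℝ) I g s t
    ((1 : ℝ →L[ℝ] ℝ).smulRight (mulInvariantVectorField (I := I) (u : GroupLieAlgebra I G) (g t)))

variable {I} {g : ℝ → G} {u : E} {s : Set ℝ} {t : ℝ}

theorem HasLeftVelocityWithinAt.congr {g' : ℝ → G} (h : HasLeftVelocityWithinAt I g u s t)
    (he : g' =ᶠ[𝓝[s] t] g) (ht : g' t = g t) : HasLeftVelocityWithinAt I g' u s t := by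
  have := HasMFDerivWithinAt.congr_of_eventuallyEq h he ht
  unfold HasLeftVelocityWithinAt
  rw [ht]
  exact this

variable [LieGroup I ∞ G]

theorem mdifferentiable_mul_left (h : G) : MDifferentiable I I (fun x : G => h * x) :=
  (contMDiff_mul_left (I := I) (n := ∞)).mdifferentiable (by simp)

theorem mfderiv_mul_left_mulInvariantVectorField (h k : G) (v : E) :
    mfderiv I I (fun x => h * x) k (mulInvariantVectorField (I := I) (v : GroupLieAlgebra I G) k) =
      mulInvariantVectorField (I := I) (v : GroupLieAlgebra I G) (h * k) := by
  have h1 : HasMFDerivAt I I (fun x : G => k * x) 1 (mfderiv I I (fun x : G => k * x) 1) :=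
    (mdifferentiable_mul_left k 1).hasMFDerivAt
  have h2 : HasMFDerivAt I I (fun x : G => h * x) (k * 1)
      (mfderiv I I (fun x : G => h * x) (k * 1)) :=
    (mdifferentiable_mul_left h (k * 1)).hasMFDerivAt
  have h3 := h2.comp (1 : G) h1
  have h4 : (fun x : G => h * x) ∘ (fun x : G => k * x) = fun x => h * k * x := by
    ext x
    simp [mul_assoc]
  rw [h4] at h3
  have h5 : ∀ k', k' = k * 1 → mfderiv I I (fun x : G => h * x) k'
      (mfderiv I I (fun x : G => k * x) 1 v : E) = mfderiv I I (fun x : G => h * k * x) 1 v := by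
    rintro _ rfl
    exact (congrArg (fun L => L v) h3.mfderiv).symm
  exact h5 k (mul_one k).symm

theorem HasLeftVelocityWithinAt.mul_left (hg : HasLeftVelocityWithinAt I g u s t) (h : G) :
    HasLeftVelocityWithinAt I (fun τ => h * g τ) u s t := by
  have h1 := (mdifferentiable_mul_left (I := I) h (g t)).hasMFDerivAt.comp_hasMFDerivWithinAt t hg
  unfold HasLeftVelocityWithinAt
  rw [← mfderiv_mul_left_mulInvariantVectorField]
  refine (congrArg (HasMFDerivWithinAt 𝓘(ℝ, ℝ) I _ s t) ?_).mp h1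
  exact comp_smulRight_one (E := E) (F := E) _ _

variable [I.Boundaryless]

theorem hasLeftVelocityWithinAt_extChartAt_symm {y : ℝ → E}
    (hy : HasDerivWithinAt y (leftFrame I G (y t) u) s t)
    (ht : y t ∈ (extChartAt I (1 : G)).target) :
    HasLeftVelocityWithinAt I (fun τ => (extChartAt I (1 : G)).symm (y τ)) u s t := by
  have h1 := (hasMFDerivAt_extChartAt_symm ht).comp_hasMFDerivWithinAt t
    hy.hasFDerivWithinAt.hasMFDerivWithinAt
  unfold HasLeftVelocityWithinAt
  rw [mulInvariantVectorField_extChartAt_symm ht]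
  refine (congrArg (HasMFDerivWithinAt 𝓘(ℝ, ℝ) I _ s t) ?_).mp h1
  rw [← smulRight_one_eq_toSpanSingleton]
  exact comp_smulRight_one (E := E) (F := E) _ _

theorem HasLeftVelocityWithinAt.hasDerivWithinAt_extChartAt
    (hg : HasLeftVelocityWithinAt I g u s t) (ht : g t ∈ (extChartAt I (1 : G)).source) :
    HasDerivWithinAt (fun τ => extChartAt I (1 : G) (g τ))
      (leftFrame I G (extChartAt I (1 : G) (g t)) u) s t := by
  have : IsManifold I 1 G := IsManifold.of_le (n := ∞) (by simp)
  have hd : HasMFDerivAt I 𝓘(ℝ, E) (extChartAt I (1 : G)) (g t)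
      (mfderiv I 𝓘(ℝ, E) (extChartAt I (1 : G)) (g t)) :=
    (mdifferentiableAt_extChartAt (I := I) (x := (1 : G)) (by
      rwa [← extChartAt_source I])).hasMFDerivAt
  have h1 := hd.comp_hasMFDerivWithinAt t hg
  have hx := (extChartAt I (1 : G)).map_source ht
  have h2 : mfderiv I 𝓘(ℝ, E) (extChartAt I (1 : G)) (g t)
      (mulInvariantVectorField (I := I) (u : GroupLieAlgebra I G) (g t)) =
      leftFrame I G (extChartAt I (1 : G) (g t)) u := by
    have h3 := mulInvariantVectorField_extChartAt_symm hx u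
    have h4 := mfderiv_extChartAt_comp_mfderivWithin_extChartAt_symm (I := I) hx
    rw [I.range_eq_univ, mfderivWithin_univ] at h4
    rw [(extChartAt I (1 : G)).left_inv ht] at h3 h4
    rw [h3]
    exact congrArg (fun L : E →L[ℝ] E => L (leftFrame I G (extChartAt I (1 : G) (g t)) u)) h4
  have h5 := hasMFDerivWithinAt_iff_hasFDerivWithinAt.1 h1
  rw [hasDerivWithinAt_iff_hasFDerivWithinAt]
  refine (congrArg (fun L => HasFDerivWithinAt _ L s t) ?_).mp h5
  rw [← h2]
  exact (comp_smulRight_one (E := E) (F := E) _ _).trans (smulRight_one_eq_toSpanSingleton (F := E) _)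

/-- The left-trivialized velocity of the product of two curves, the second one being given by its
coordinates at the identity. -/
theorem HasLeftVelocityWithinAt.mul_extChartAt_symm {x : ℝ → E} {x' ζ : E}
    (hg : HasLeftVelocityWithinAt I g u s t)
    (hx : HasDerivWithinAt x x' s t) (ht : x t ∈ (extChartAt I (1 : G)).target)
    (hts : t ∈ s)
    (hζ : leftFrame I G (x t) ζ = rightFrame I G (x t) u + x') :
    HasLeftVelocityWithinAt I (fun τ => g τ * (extChartAt I (1 : G)).symm (x τ)) ζ s t := by
  have hk := hg.mul_left (g t)⁻¹
  have hkt : (g t)⁻¹ * g t = 1 := inv_mul_cancel _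
  have hy := hk.hasDerivWithinAt_extChartAt (by rw [hkt]; exact mem_extChartAt_source 1)
  set y : ℝ → E := fun τ => extChartAt I (1 : G) ((g t)⁻¹ * g τ) with hydef
  have hyt : y t = chartOne I G := by rw [hydef]; simp only [hkt]; rfl
  rw [show extChartAt I (1 : G) ((g t)⁻¹ * g t) = chartOne I G from hyt, leftFrame_chartOne] at hy
  have hF : HasDerivWithinAt (fun τ => chartMul I G (y τ, x τ)) (rightFrame I G (x t) u + x') s t := by
    have h1 := hasFDerivAt_chartMul_chartOne_left (I := I) (G := G) ht
    rw [← hyt] at h1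
    have h2 := HasFDerivAt.comp_hasDerivWithinAt t (f := fun τ => (y τ, x τ)) h1 (hy.prodMk hx)
    convert! h2 using 1
    have h3 := congrArg (fun L : E →L[ℝ] E => L x') (fderiv_chartMul_comp_inr (I := I) (G := G) ht)
    simp only [ContinuousLinearMap.comp_apply, ContinuousLinearMap.inr_apply,
      ContinuousLinearMap.id_apply] at h3
    rw [hyt]
    nth_rewrite 1 [← h3]
    rw [rightFrame, ContinuousLinearMap.comp_apply, ContinuousLinearMap.inl_apply, ← map_add]
    simp
  have hFt : chartMul I G (y t, x t) = x t := by rw [hyt, chartMul_chartOne_left ht]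
  rw [← hζ, ← hFt] at hF
  have hv := (hasLeftVelocityWithinAt_extChartAt_symm hF (by rwa [hFt])).mul_left (g t)
  have hgc : ContinuousWithinAt g s t := HasMFDerivWithinAt.continuousWithinAt hg
  have hmul : ContinuousWithinAt
      (fun τ => (g t)⁻¹ * g τ * (extChartAt I (1 : G)).symm (x τ)) s t := by
    have hxc : ContinuousWithinAt (fun τ => (extChartAt I (1 : G)).symm (x τ)) s t :=
      (contMDiffAt_extChartAt_symm ht).continuousAt.comp_continuousWithinAt hx.continuousWithinAt
    have : ContinuousMul G := continuousMul_of_contMDiffMul I ∞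
    exact (continuousWithinAt_const.mul hgc).mul hxc
  have heq : (fun τ => g τ * (extChartAt I (1 : G)).symm (x τ)) =ᶠ[𝓝[s] t]
      fun τ => g t * (extChartAt I (1 : G)).symm (chartMul I G (y τ, x τ)) := by
    have n1 : (extChartAt I (1 : G)).source ∈
        𝓝 ((g t)⁻¹ * g t * (extChartAt I (1 : G)).symm (x t)) := by
      rw [hkt, one_mul]
      exact (isOpen_extChartAt_source (1 : G)).mem_nhds ((extChartAt I (1 : G)).map_target ht)
    have n2 : (extChartAt I (1 : G)).source ∈ 𝓝 ((g t)⁻¹ * g t) := by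
      rw [hkt]
      exact extChartAt_source_mem_nhds 1
    filter_upwards [hmul.preimage_mem_nhdsWithin n1,
      (HasMFDerivWithinAt.continuousWithinAt hk).preimage_mem_nhdsWithin n2] with τ h1 h2
    simp only [hydef, chartMul]
    rw [(extChartAt I (1 : G)).left_inv h2, (extChartAt I (1 : G)).left_inv h1]
    group
  exact hv.congr heq (heq.eq_of_nhdsWithin hts)

/-- The left-trivialized velocity of a `C¹` curve is continuous. -/
theorem continuousOn_of_hasLeftVelocityWithinAt [CompleteSpace E] {u : ℝ → E}
    (hs : UniqueDiffOn ℝ s)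
    (hg : ContMDiffOn 𝓘(ℝ, ℝ) I 1 g s) (hu : ∀ t ∈ s, HasLeftVelocityWithinAt I g (u t) s t) :
    ContinuousOn u s := by
  intro t ht
  have : IsManifold I 1 G := IsManifold.of_le (n := ∞) (by simp)
  set y : ℝ → E := fun τ => extChartAt I (1 : G) ((g t)⁻¹ * g τ) with hydef
  have hkt : (g t)⁻¹ * g t = 1 := inv_mul_cancel _
  have hyt : y t = chartOne I G := by rw [hydef]; simp only [hkt]; rfl
  have hk : ContMDiffWithinAt 𝓘(ℝ, ℝ) I 1 (fun τ => (g t)⁻¹ * g τ) s t :=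
    ((contMDiff_mul_left (I := I) (n := ∞) (a := (g t)⁻¹)).of_le (by simp)).contMDiffAt
      |>.comp_contMDiffWithinAt t (hg t ht)
  have hy : ContDiffWithinAt ℝ 1 y s t := by
    rw [← contMDiffWithinAt_iff_contDiffWithinAt]
    refine ContMDiffAt.comp_contMDiffWithinAt t (g := extChartAt I (1 : G)) ?_ hk
    rw [hkt]
    exact contMDiffAt_extChartAt
  have hdy : ContinuousWithinAt (derivWithin y s) s t := by
    have h := (hy.fderivWithin_right (m := 0) hs (by simp) ht).continuousWithinAt
    exact h.clm_apply continuousWithinAt_const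
  have hfr : ContinuousWithinAt (fun τ => (leftFrame I G (y τ)).inverse) s t := by
    have h1 : ContDiffAt ℝ ∞ ContinuousLinearMap.inverse (leftFrame I G (y t)) := by
      rw [hyt, leftFrame_chartOne]
      exact contDiffAt_map_inverse (ContinuousLinearEquiv.refl ℝ E)
    have h2 : ContinuousAt (leftFrame I G) (y t) := by
      rw [hyt]
      exact (contDiffAt_leftFrame chartOne_mem_target).continuousAt
    exact ContinuousAt.comp_continuousWithinAt (f := fun τ => leftFrame I G (y τ))
      h1.continuousAt (h2.comp_continuousWithinAt hy.continuousWithinAt)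
  have hev : ∀ᶠ τ in 𝓝[s] t, u τ = (leftFrame I G (y τ)).inverse (derivWithin y s τ) := by
    have n2 : (extChartAt I (1 : G)).source ∈ 𝓝 ((g t)⁻¹ * g t) := by
      rw [hkt]
      exact extChartAt_source_mem_nhds 1
    have n3 := eventually_isInvertible_leftFrame (I := I) (G := G)
    rw [← hyt] at n3
    filter_upwards [hk.continuousWithinAt.preimage_mem_nhdsWithin n2, self_mem_nhdsWithin,
      hy.continuousWithinAt.eventually n3] with τ h1 hτ h3
    have h4 := ((hu τ hτ).mul_left (g t)⁻¹).hasDerivWithinAt_extChartAt h1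
    rw [h4.derivWithin (hs τ hτ)]
    obtain ⟨e, he⟩ := h3
    have h5 : leftFrame I G (extChartAt I (1 : G) ((g t)⁻¹ * g τ)) = e := he.symm
    rw [h5, ContinuousLinearMap.inverse_equiv]
    simp
  exact (hfr.clm_apply hdy).congr_of_eventuallyEq hev (hev.self_of_nhdsWithin ht)

end LeftVelocity

section TranslationFamily

variable {E : Type*} [NormedAddCommGroup E] [NormedSpace ℝ E] [FiniteDimensional ℝ E]
  {H : Type*} [TopologicalSpace H] (I : ModelWithCorners ℝ E H)
  (G : Type*) [TopologicalSpace G] [ChartedSpace H G] [Group G]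

/-- A `C¹` curve `c` in `G` through the identity with initial velocity `v`, together with the maps
`A` and `w` that give the velocity of products `g * c ∘ f`: `A s` is the adjoint action of
`(c s)⁻¹`, and `w` is the left-trivialized velocity of `c`. -/
structure TranslationCurve (v : E) where
  r : ℝ
  r_pos : 0 < r
  c : ℝ → G
  A : ℝ → E →L[ℝ] E
  w : ℝ → E
  c_zero : c 0 = 1
  contMDiffOn_c : ContMDiffOn 𝓘(ℝ, ℝ) I 1 c (Ioo (-r) r)
  hasMFDerivAt_c : HasMFDerivAt 𝓘(ℝ, ℝ) I c 0
    (ContinuousLinearMap.toSpanSingleton ℝ v : ℝ →L[ℝ] E)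
  contDiffOn_A : ContDiffOn ℝ 1 A (Ioo (-r) r)
  contDiffOn_w : ContDiffOn ℝ 1 w (Ioo (-r) r)
  A_zero : A 0 = ContinuousLinearMap.id ℝ E
  w_zero : w 0 = v

variable {I G} [LieGroup I ∞ G] [I.Boundaryless]

theorem exists_translationCurve (v : E) : ∃ c : TranslationCurve I G v,
    (∀ u, deriv c.A 0 u = ad I G u v) ∧
    ∀ (g : ℝ → G) (u : E) (s : Set ℝ) (t : ℝ) (f : ℝ → ℝ) (f' : ℝ), t ∈ s →
      f t ∈ Ioo (-c.r) c.r → HasDerivWithinAt f f' s t → HasLeftVelocityWithinAt I g u s t →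
      HasLeftVelocityWithinAt I (fun τ => g τ * c.c (f τ)) (c.A (f t) u + f' • c.w (f t)) s t := by
  have : CompleteSpace E := FiniteDimensional.complete ℝ E
  set x : ℝ → E := fun s => chartOne I G + s • v with hx
  have hx0 : x 0 = chartOne I G := by simp [hx]
  have hxd (s : ℝ) : HasDerivAt x v s := by
    have h := ((hasDerivAt_id s).smul_const v).const_add (chartOne I G)
    rw [one_smul] at h
    exact h
  have hxs : ContDiff ℝ ∞ x := contDiff_const.add (contDiff_id.smul contDiff_const)
  obtain ⟨r, hr, hgood⟩ : ∃ r > 0, ∀ s ∈ Ioo (-r) r, x s ∈ (extChartAt I (1 : G)).target ∧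
      (leftFrame I G (x s)).IsInvertible := by
    have h1 : ∀ᶠ y in 𝓝 (x 0), y ∈ (extChartAt I (1 : G)).target ∧
        (leftFrame I G y).IsInvertible := by
      rw [hx0]
      filter_upwards [extChartAt_target_mem_nhds_of_mem chartOne_mem_target,
        eventually_isInvertible_leftFrame] with y h1 h2 using ⟨h1, h2⟩
    obtain ⟨r, hr, h2⟩ := Metric.eventually_nhds_iff.1
      ((hxd 0).continuousAt.eventually h1)
    refine ⟨r, hr, fun s hs => h2 ?_⟩
    rw [Real.dist_eq, sub_zero]
    exact abs_lt.2 hs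
  have h0 : (0 : ℝ) ∈ Ioo (-r) r := ⟨by linarith, hr⟩
  have hB (s : ℝ) (hs : s ∈ Ioo (-r) r) : ContDiffAt ℝ ∞ (fun s => leftFrame I G (x s)) s :=
    (contDiffAt_leftFrame (hgood s hs).1).comp s hxs.contDiffAt
  have hR (s : ℝ) (hs : s ∈ Ioo (-r) r) : ContDiffAt ℝ ∞ (fun s => rightFrame I G (x s)) s :=
    (contDiffAt_rightFrame (hgood s hs).1).comp s hxs.contDiffAt
  have hN (s : ℝ) (hs : s ∈ Ioo (-r) r) :
      ContDiffAt ℝ ∞ (fun s => (leftFrame I G (x s)).inverse) s := by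
    obtain ⟨e, he⟩ := (hgood s hs).2
    have h1 : ContDiffAt ℝ ∞ ContinuousLinearMap.inverse (leftFrame I G (x s)) := by
      rw [← he]
      exact contDiffAt_map_inverse e
    exact h1.comp s (hB s hs)
  have hA (s : ℝ) (hs : s ∈ Ioo (-r) r) : ContDiffAt ℝ ∞
      (fun s => (leftFrame I G (x s)).inverse.comp (rightFrame I G (x s))) s :=
    (hN s hs).clm_comp (hR s hs)
  have hw (s : ℝ) (hs : s ∈ Ioo (-r) r) : ContDiffAt ℝ ∞
      (fun s => (leftFrame I G (x s)).inverse v) s :=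
    (hN s hs).clm_apply contDiffAt_const
  have hinv (s : ℝ) (hs : s ∈ Ioo (-r) r) (z : E) :
      leftFrame I G (x s) ((leftFrame I G (x s)).inverse z) = z := by
    obtain ⟨e, he⟩ := (hgood s hs).2
    rw [← he, ContinuousLinearMap.inverse_equiv]
    simp
  have : IsManifold I 1 G := IsManifold.of_le (n := ∞) (by simp)
  refine ⟨{ r := r, r_pos := hr
            c := fun s => (extChartAt I (1 : G)).symm (x s)
            A := fun s => (leftFrame I G (x s)).inverse.comp (rightFrame I G (x s))
            w := fun s => (leftFrame I G (x s)).inverse v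
            c_zero := by simp only [hx0, extChartAt_symm_chartOne]
            contMDiffOn_c := fun s hs => ?_
            hasMFDerivAt_c := ?_
            contDiffOn_A := fun s hs => ((hA s hs).of_le (by simp)).contDiffWithinAt
            contDiffOn_w := fun s hs => ((hw s hs).of_le (by simp)).contDiffWithinAt
            A_zero := by
              simp only [hx0, leftFrame_chartOne, rightFrame_chartOne]
              simp
            w_zero := by
              simp only [hx0, leftFrame_chartOne]
              simp }, ?_, ?_⟩
  · exact (((contMDiffAt_extChartAt_symm (hgood s hs).1).comp s
      hxs.contMDiff.contMDiffAt).of_le (by simp)).contMDiffWithinAt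
  · have h1 := hasMFDerivAt_extChartAt_symm (I := I) (G := G) (hgood 0 h0).1
    have h2 := h1.comp 0 (hxd 0).hasFDerivAt.hasMFDerivAt
    refine (congrArg (HasMFDerivAt 𝓘(ℝ, ℝ) I _ 0) ?_).mp h2
    have h3 := mfderivWithin_range_extChartAt_symm (I := I) (x := (1 : G))
    rw [I.range_eq_univ, mfderivWithin_univ] at h3
    have h4 : mfderiv 𝓘(ℝ, E) I (extChartAt I (1 : G)).symm (x 0) =
        ContinuousLinearMap.id ℝ E := by
      rw [hx0]
      exact h3
    rw [h4]
    exact ContinuousLinearMap.id_comp (M₂ := E) _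
  · intro u
    dsimp only
    have hd := ((hA 0 h0).differentiableAt (by simp)).hasDerivAt
    have hxB : HasDerivAt (fun s => leftFrame I G (x s))
        (fderiv ℝ (leftFrame I G) (chartOne I G) v) 0 := by
      have h1 := ((contDiffAt_leftFrame (I := I) (G := G)
        (hgood 0 h0).1).differentiableAt (by simp)).hasFDerivAt
      have h2 := h1.comp_hasDerivAt 0 (hxd 0)
      rwa [hx0] at h2
    have hxR : HasDerivAt (fun s => rightFrame I G (x s))
        (fderiv ℝ (rightFrame I G) (chartOne I G) v) 0 := by
      have h1 := ((contDiffAt_rightFrame (I := I) (G := G)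
        (hgood 0 h0).1).differentiableAt (by simp)).hasFDerivAt
      have h2 := h1.comp_hasDerivAt 0 (hxd 0)
      rwa [hx0] at h2
    have heq : (fun s => (leftFrame I G (x s)).comp
        ((leftFrame I G (x s)).inverse.comp (rightFrame I G (x s)))) =ᶠ[𝓝 0]
        fun s => rightFrame I G (x s) := by
      filter_upwards [isOpen_Ioo.mem_nhds h0] with s hs
      ext z
      exact hinv s hs _
    have huniq := ((hxB.clm_comp hd).congr_of_eventuallyEq heq.symm).unique hxR
    have h5 := congrArg (fun L : E →L[ℝ] E => L u) huniq
    simp only [hx0, leftFrame_chartOne, rightFrame_chartOne, add_apply,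
      ContinuousLinearMap.inverse_id, ContinuousLinearMap.id_comp,
      ContinuousLinearMap.comp_id, fderiv_rightFrame_eq] at h5
    rw [ad_apply, ← h5]
    abel
  · intro g u s t f f' hts hft hf hg
    have hxf : HasDerivWithinAt (fun τ => x (f τ)) (f' • v) s t :=
      (hxd (f t)).scomp_hasDerivWithinAt t hf
    refine hg.mul_extChartAt_symm hxf (hgood _ hft).1 hts ?_
    rw [map_add, map_smul]
    dsimp only
    rw [ContinuousLinearMap.comp_apply, hinv _ hft, hinv _ hft]

end TranslationFamily

/-- The lemma of du Bois-Reymond. -/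
theorem hasDerivWithinAt_of_forall_integral_eq_zero {T : ℝ} (hT : 0 < T) {a b : ℝ → ℝ}
    (ha : ContinuousOn a (Icc 0 T)) (hb : ContinuousOn b (Icc 0 T))
    (h : ∀ f f' : ℝ → ℝ, Continuous f' → (∀ t, HasDerivAt f (f' t) t) → f 0 = 0 → f T = 0 →
      ∫ t in (0 : ℝ)..T, (f' t * a t + f t * b t) = 0) :
    ∀ t ∈ Icc 0 T, HasDerivWithinAt a (b t) (Icc 0 T) t := by
  set a₁ : ℝ → ℝ := IccExtend hT.le ((Icc 0 T).domRestrict a)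
  set b₁ : ℝ → ℝ := IccExtend hT.le ((Icc 0 T).domRestrict b)
  have ha₁ : Continuous a₁ := (continuousOn_iff_continuous_domRestrict.1 ha).Icc_extend'
  have hb₁ : Continuous b₁ := (continuousOn_iff_continuous_domRestrict.1 hb).Icc_extend'
  have haeq (t : ℝ) (ht : t ∈ Icc 0 T) : a₁ t = a t := IccExtend_of_mem hT.le _ ht
  have hbeq (t : ℝ) (ht : t ∈ Icc 0 T) : b₁ t = b t := IccExtend_of_mem hT.le _ ht
  set B : ℝ → ℝ := fun t => ∫ s in (0 : ℝ)..t, b₁ s with hB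
  have hBd (t : ℝ) : HasDerivAt B (b₁ t) t := hb₁.integral_hasStrictDerivAt 0 t |>.hasDerivAt
  have hBc : Continuous B := continuous_iff_continuousAt.2 fun t => (hBd t).continuousAt
  set k : ℝ := (∫ t in (0 : ℝ)..T, (a₁ t - B t)) / T with hk
  set f' : ℝ → ℝ := fun t => a₁ t - B t - k with hf'
  have hf'c : Continuous f' := (ha₁.sub hBc).sub continuous_const
  set f : ℝ → ℝ := fun t => ∫ s in (0 : ℝ)..t, f' s with hf
  have hfd (t : ℝ) : HasDerivAt f (f' t) t := hf'c.integral_hasStrictDerivAt 0 t |>.hasDerivAt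
  have hfc : Continuous f := continuous_iff_continuousAt.2 fun t => (hfd t).continuousAt
  have hf0 : f 0 = 0 := by simp [hf]
  have hfT : f T = 0 := by
    simp only [hf, hf']
    have hd : Continuous fun t => a₁ t - B t := ha₁.sub hBc
    rw [intervalIntegral.integral_sub (hd.intervalIntegrable _ _)
      (continuous_const.intervalIntegrable _ _), intervalIntegral.integral_const, hk]
    simp only [sub_zero, smul_eq_mul]
    field_simp
    ring
  have hmain := h f f' hf'c hfd hf0 hfT
  have hparts : ∫ t in (0 : ℝ)..T, (f' t * B t + f t * b₁ t) = 0 := by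
    rw [intervalIntegral.integral_deriv_mul_eq_sub (fun t _ => hfd t) (fun t _ => hBd t)
      (hf'c.intervalIntegrable _ _) (hb₁.intervalIntegrable _ _), hf0, hfT]
    simp
  have hsq : ∫ t in (0 : ℝ)..T, f' t * f' t = 0 := by
    have e : ∫ t in (0 : ℝ)..T, (f' t * a t + f t * b t) =
        ∫ t in (0 : ℝ)..T, (f' t * a₁ t + f t * b₁ t) := by
      refine intervalIntegral.integral_congr fun t ht => ?_
      rw [uIcc_of_le hT.le] at ht
      simp only [haeq t ht, hbeq t ht]
    have e2 : ∫ t in (0 : ℝ)..T, f' t * f' t = (∫ t in (0 : ℝ)..T, (f' t * a₁ t + f t * b₁ t)) -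
        (∫ t in (0 : ℝ)..T, (f' t * B t + f t * b₁ t)) - ∫ t in (0 : ℝ)..T, f' t * k := by
      rw [← intervalIntegral.integral_sub, ← intervalIntegral.integral_sub]
      · refine intervalIntegral.integral_congr fun t _ => ?_
        simp only [hf']
        ring
      all_goals exact Continuous.intervalIntegrable (by fun_prop) _ _
    rw [e2, ← e, hmain, hparts, intervalIntegral.integral_mul_const]
    have : ∫ t in (0 : ℝ)..T, f' t = 0 := hfT
    rw [this]
    simp
  have hzero : ∀ t ∈ Icc 0 T, f' t = 0 := by
    intro t ht
    by_contra hne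
    have hpos : 0 < ∫ t in (0 : ℝ)..T, f' t * f' t :=
      intervalIntegral.integral_pos hT (hf'c.mul hf'c).continuousOn
        (fun s _ => mul_self_nonneg _) ⟨t, ht, mul_self_pos.2 hne⟩
    exact hpos.ne' hsq
  intro t ht
  have heq (s : ℝ) (hs : s ∈ Icc 0 T) : a s = B s + k := by
    have := hzero s hs
    simp only [hf'] at this
    rw [← haeq s hs]
    linarith
  have hd := ((hBd t).add_const k).hasDerivWithinAt (s := Icc 0 T)
  rw [hbeq t ht] at hd
  exact hd.congr heq (heq t ht)

/-- Differentiation under the integral sign over a compact interval. -/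
theorem hasDerivAt_integral_of_continuousOn {δ T : ℝ} (hδ : 0 < δ) (hT : 0 ≤ T) {F F' : ℝ → ℝ → ℝ}
    (hF : ContinuousOn (fun q : ℝ × ℝ => F q.1 q.2) (Ioo (-δ) δ ×ˢ Icc 0 T))
    (hF' : ContinuousOn (fun q : ℝ × ℝ => F' q.1 q.2) (Ioo (-δ) δ ×ˢ Icc 0 T))
    (hd : ∀ ε ∈ Ioo (-δ) δ, ∀ t ∈ Icc 0 T, HasDerivAt (fun s => F s t) (F' ε t) ε) :
    HasDerivAt (fun ε => ∫ t in (0 : ℝ)..T, F ε t) (∫ t in (0 : ℝ)..T, F' 0 t) 0 := by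
  have hslice {K : ℝ → ℝ → ℝ}
      (hK : ContinuousOn (fun q : ℝ × ℝ => K q.1 q.2) (Ioo (-δ) δ ×ˢ Icc 0 T))
      {ε : ℝ} (hε : ε ∈ Ioo (-δ) δ) : ContinuousOn (K ε) (uIcc 0 T) := by
    rw [uIcc_of_le hT]
    exact hK.comp (f := fun t => (ε, t)) (by fun_prop) fun t ht => ⟨hε, ht⟩
  have h0 : (0 : ℝ) ∈ Ioo (-δ) δ := ⟨by linarith, hδ⟩
  have hsub : Icc (-(δ / 2)) (δ / 2) ⊆ Ioo (-δ) δ := fun ε hε =>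
    ⟨by linarith [hε.1], by linarith [hε.2]⟩
  obtain ⟨M, hM⟩ := (isCompact_Icc (a := -(δ / 2)) (b := δ / 2)).prod
    (isCompact_Icc (a := (0 : ℝ)) (b := T)) |>.exists_bound_of_continuousOn
      (hF'.mono (prod_mono hsub subset_rfl))
  have hmem {t : ℝ} (ht : t ∈ uIoc 0 T) : t ∈ Icc 0 T := by
    rw [uIoc_of_le hT] at ht
    exact Ioc_subset_Icc_self ht
  refine (intervalIntegral.hasDerivAt_integral_of_dominated_loc_of_deriv_le (μ := volume)
    (bound := fun _ => M)
    (s := Icc (-(δ / 2)) (δ / 2)) (Icc_mem_nhds (by linarith) (by linarith)) ?_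
    (hslice hF h0).intervalIntegrable ?_ ?_ (by simp) ?_).2
  · filter_upwards [isOpen_Ioo.mem_nhds h0] with ε hε
    exact ((hslice hF hε).aestronglyMeasurable measurableSet_uIcc).mono_set uIoc_subset_uIcc
  · exact ((hslice hF' h0).aestronglyMeasurable measurableSet_uIcc).mono_set uIoc_subset_uIcc
  · exact ae_of_all _ fun t ht ε hε => hM (ε, t) ⟨hε, hmem ht⟩
  · exact ae_of_all _ fun t ht ε hε => hd ε (hsub hε) t (hmem ht)

section Representation

theorem rhoStar_mul {G X : Type*} [Group G] [NormedAddCommGroup X]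
    [NormedSpace ℝ X] (ρ : G →* (X →L[ℝ] X)) (g h : G) (α : StrongDual ℝ X) :
    rhoStar ρ (g * h) α = (rhoStar ρ g α).comp (ρ h) := by
  ext x
  simp [rhoStar]

variable {E : Type*} [NormedAddCommGroup E] [NormedSpace ℝ E]
  {H : Type*} [TopologicalSpace H] {I : ModelWithCorners ℝ E H}
  {G : Type*} [TopologicalSpace G] [ChartedSpace H G] [Group G]
  {X : Type*} [NormedAddCommGroup X] [NormedSpace ℝ X]

theorem TranslationCurve.hasDerivAt_representation {v : E}
    (c : TranslationCurve I G v) (ρ : G →* (X →L[ℝ] X))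
    (hρ : ContMDiff I 𝓘(ℝ, X →L[ℝ] X) ∞ (fun g => ρ g)) :
    HasDerivAt (fun s => ρ (c.c s)) (rhoPrime I ρ v) 0 := by
  have hd : HasMFDerivAt I 𝓘(ℝ, X →L[ℝ] X) (fun g => ρ g) (c.c 0)
      (rhoPrime I ρ : E →L[ℝ] (X →L[ℝ] X)) := by
    rw [c.c_zero]
    exact (hρ.mdifferentiable (by simp) 1).hasMFDerivAt
  have h1 := hasMFDerivAt_iff_hasFDerivAt.1 (hd.comp 0 c.hasMFDerivAt_c)
  rw [hasDerivAt_iff_hasFDerivAt]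
  refine (congrArg (fun L => HasFDerivAt _ L 0) ?_).mp h1
  rw [← smulRight_one_eq_toSpanSingleton, ← smulRight_one_eq_toSpanSingleton]
  exact comp_smulRight_one (E := E) (F := X →L[ℝ] X) _ _

theorem TranslationCurve.contDiffOn_representation {v : E}
    (c : TranslationCurve I G v) (ρ : G →* (X →L[ℝ] X))
    (hρ : ContMDiff I 𝓘(ℝ, X →L[ℝ] X) ∞ (fun g => ρ g)) :
    ContDiffOn ℝ 1 (fun s => ρ (c.c s)) (Ioo (-c.r) c.r) := by
  rw [← contMDiffOn_iff_contDiffOn]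
  exact (hρ.of_le (by simp)).comp_contMDiffOn c.contMDiffOn_c

variable [LieGroup I ∞ G]

theorem mfderiv_representation_apply (ρ : G →* (X →L[ℝ] X))
    (hρ : ContMDiff I 𝓘(ℝ, X →L[ℝ] X) ∞ (fun g => ρ g)) (h : G) (v : E) :
    (mfderiv I 𝓘(ℝ, X →L[ℝ] X) (fun g => ρ g) h
      (mulInvariantVectorField (I := I) (v : GroupLieAlgebra I G) h) : X →L[ℝ] X) =
      (ρ h).comp (rhoPrime I ρ v) := by
  have hd (k : G) : HasMFDerivAt I 𝓘(ℝ, X →L[ℝ] X) (fun g => ρ g) k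
      (mfderiv I 𝓘(ℝ, X →L[ℝ] X) (fun g => ρ g) k) :=
    (hρ.mdifferentiable (by simp) k).hasMFDerivAt
  have h1 : HasMFDerivAt I I (fun x : G => h * x) 1 (mfderiv I I (fun x : G => h * x) 1) :=
    (mdifferentiable_mul_left h 1).hasMFDerivAt
  have h2 := (hd (h * 1)).comp (1 : G) h1
  have h3 : HasMFDerivAt 𝓘(ℝ, X →L[ℝ] X) 𝓘(ℝ, X →L[ℝ] X) (fun B : X →L[ℝ] X => (ρ h).comp B)
      (ρ 1) (ContinuousLinearMap.compL ℝ X X X (ρ h)) :=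
    ((ContinuousLinearMap.compL ℝ X X X (ρ h)).hasFDerivAt).hasMFDerivAt
  have h4 := HasMFDerivAt.comp (1 : G) h3 (hd 1)
  have h5 : (fun g => ρ g) ∘ (fun x : G => h * x) = (fun B : X →L[ℝ] X => (ρ h).comp B) ∘
      (fun g => ρ g) := by
    ext x z
    simp
  rw [h5] at h2
  have h6 := h2.mfderiv.symm.trans h4.mfderiv
  have h7 : ∀ k', k' = h * 1 → (mfderiv I 𝓘(ℝ, X →L[ℝ] X) (fun g => ρ g) k'
      (mfderiv I I (fun x : G => h * x) 1 v : E) : X →L[ℝ] X) = (ρ h).comp (rhoPrime I ρ v) := by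
    rintro _ rfl
    exact congrArg (fun L => L v) h6
  exact h7 h (mul_one h).symm

theorem HasLeftVelocityWithinAt.hasDerivWithinAt_representation (ρ : G →* (X →L[ℝ] X))
    (hρ : ContMDiff I 𝓘(ℝ, X →L[ℝ] X) ∞ (fun g => ρ g)) {g : ℝ → G} {u : E} {s : Set ℝ} {t : ℝ}
    (hg : HasLeftVelocityWithinAt I g u s t) :
    HasDerivWithinAt (fun τ => ρ (g τ)) ((ρ (g t)).comp (rhoPrime I ρ u)) s t := by
  have hd : HasMFDerivAt I 𝓘(ℝ, X →L[ℝ] X) (fun g => ρ g) (g t)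
      (mfderiv I 𝓘(ℝ, X →L[ℝ] X) (fun g => ρ g) (g t)) :=
    (hρ.mdifferentiable (by simp) (g t)).hasMFDerivAt
  have h1 := hasMFDerivWithinAt_iff_hasFDerivWithinAt.1 (hd.comp_hasMFDerivWithinAt t hg)
  rw [hasDerivWithinAt_iff_hasFDerivWithinAt]
  refine (congrArg (fun L => HasFDerivWithinAt _ L s t) ?_).mp h1
  rw [← mfderiv_representation_apply ρ hρ]
  exact (comp_smulRight_one (E := E) (F := X →L[ℝ] X) _ _).trans
    (smulRight_one_eq_toSpanSingleton (F := X →L[ℝ] X) _)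

end Representation

namespace Problem

variable {E : Type*} [NormedAddCommGroup E] [NormedSpace ℝ E]
  {H : Type*} [TopologicalSpace H] {I : ModelWithCorners ℝ E H}
  {G : Type*} [TopologicalSpace G] [ChartedSpace H G] [Group G]
  {X : Type*} [NormedAddCommGroup X] [NormedSpace ℝ X]
  (P : Problem I G X)

theorem C_eq (g : G) (w : P.𝔨) : P.C (g, w) = P.C (1, w) := by
  simpa using P.C_invariant g 1 w

theorem Vext_eq (g : G) (α : StrongDual ℝ X) :
    P.Vext (g, α) = P.Vext (1, rhoStar P.ρ g α) := by
  simpa using (P.Vext_invariant g⁻¹ g α).symm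

theorem contDiff_C : ContDiff ℝ 1 (fun w : P.𝔨 => P.C (1, w)) := by
  rw [← contMDiff_iff_contDiff]
  exact P.C_contMDiff.comp (contMDiff_const.prodMk contMDiff_id)

theorem contDiff_Vext : ContDiff ℝ 1 (fun α : StrongDual ℝ X => P.Vext (1, α)) := by
  rw [← contMDiff_iff_contDiff]
  exact P.Vext_contMDiff.comp (contMDiff_const.prodMk contMDiff_id)

theorem augLagrangian_eq [FiniteDimensional ℝ E] (g h : G) (ξ : E) (l : StrongDual ℝ P.𝔭) :
    P.augLagrangian (g * h) ξ l P.α₀ = P.C (1, P.projK (ξ - P.e₀)) +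
      P.Vext (1, (rhoStar P.ρ g P.α₀).comp (P.ρ h)) + P.inclP l (ξ - P.e₀) := by
  rw [augLagrangian, P.C_eq, P.Vext_eq, rhoStar_mul]

theorem hasDerivWithinAt_advected [LieGroup I ∞ G] {g : ℝ → G} {u : E} {s : Set ℝ} {t : ℝ}
    (hg : HasLeftVelocityWithinAt I g u s t) :
    HasDerivWithinAt (P.advected g) (rhoPrimeStar I P.ρ u (P.advected g t)) s t := by
  have h1 := hg.hasDerivWithinAt_representation P.ρ P.ρ_contMDiff
  exact ((ContinuousLinearMap.compL ℝ X X ℝ P.α₀).hasFDerivAt).comp_hasDerivWithinAt t h1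

end Problem

variable {E : Type*} [NormedAddCommGroup E] [NormedSpace ℝ E]
  {H : Type*} [TopologicalSpace H] {I : ModelWithCorners ℝ E H}
  {G : Type*} [TopologicalSpace G] [ChartedSpace H G] [Group G] [LieGroup I ∞ G]
  {X : Type*} [NormedAddCommGroup X] [NormedSpace ℝ X]

/-- The variation `Γ ε t = g t * c (ε f t)` generated by a curve `c` through the identity. -/
theorem isVariation_mul {T : ℝ} {g : ℝ → G} {u : ℝ → E}
    (hg : ContMDiffOn 𝓘(ℝ, ℝ) I 1 g (Icc 0 T)) (hu : HasLeftVelocity I T g u)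
    (huc : ContinuousOn u (Icc 0 T)) {v : E} (c : TranslationCurve I G v)
    (hc : ∀ (g : ℝ → G) (u : E) (s : Set ℝ) (t : ℝ) (f : ℝ → ℝ) (f' : ℝ), t ∈ s →
      f t ∈ Ioo (-c.r) c.r → HasDerivWithinAt f f' s t → HasLeftVelocityWithinAt I g u s t →
      HasLeftVelocityWithinAt I (fun τ => g τ * c.c (f τ)) (c.A (f t) u + f' • c.w (f t)) s t)
    {f f' : ℝ → ℝ} (hf' : Continuous f') (hf : ∀ t, HasDerivAt f (f' t) t)
    (hf0 : f 0 = 0) (hfT : f T = 0) {δ : ℝ}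
    (hr : ∀ q ∈ Ioo (-δ) δ ×ˢ Icc 0 T, q.1 * f q.2 ∈ Ioo (-c.r) c.r) :
    IsVariation I T δ g (fun ε t => g t * c.c (ε * f t))
      (fun ε t => c.A (ε * f t) (u t) + (ε * f' t) • c.w (ε * f t)) ∧
    (∀ q ∈ Ioo (-δ) δ ×ˢ Icc 0 T, HasDerivAt
      (fun ε => c.A (ε * f q.2) (u q.2) + (ε * f' q.2) • c.w (ε * f q.2))
      (f q.2 • deriv c.A (q.1 * f q.2) (u q.2) +
        (f' q.2 • c.w (q.1 * f q.2) + (q.1 * f' q.2 * f q.2) • deriv c.w (q.1 * f q.2))) q.1) ∧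
    ContinuousOn (fun q : ℝ × ℝ => f q.2 • deriv c.A (q.1 * f q.2) (u q.2) +
        (f' q.2 • c.w (q.1 * f q.2) + (q.1 * f' q.2 * f q.2) • deriv c.w (q.1 * f q.2)))
      (Ioo (-δ) δ ×ˢ Icc 0 T) := by
  have hfc : Continuous f := continuous_iff_continuousAt.2 fun t => (hf t).continuousAt
  have hf1 : ContDiff ℝ 1 f := by
    rw [contDiff_one_iff_deriv]
    exact ⟨fun t => (hf t).differentiableAt, by rwa [funext fun t => (hf t).deriv]⟩
  have hσ : Continuous fun q : ℝ × ℝ => q.1 * f q.2 := by fun_prop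
  have hsnd : MapsTo (Prod.snd : ℝ × ℝ → ℝ) (Ioo (-δ) δ ×ˢ Icc 0 T) (Icc 0 T) := fun q hq => hq.2
  have hAc : ContinuousOn (fun q : ℝ × ℝ => c.A (q.1 * f q.2)) (Ioo (-δ) δ ×ˢ Icc 0 T) :=
    c.contDiffOn_A.continuousOn.comp hσ.continuousOn hr
  have hwc : ContinuousOn (fun q : ℝ × ℝ => c.w (q.1 * f q.2)) (Ioo (-δ) δ ×ˢ Icc 0 T) :=
    c.contDiffOn_w.continuousOn.comp hσ.continuousOn hr
  have hA'c : ContinuousOn (fun q : ℝ × ℝ => deriv c.A (q.1 * f q.2)) (Ioo (-δ) δ ×ˢ Icc 0 T) :=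
    (c.contDiffOn_A.continuousOn_deriv_of_isOpen isOpen_Ioo le_rfl).comp hσ.continuousOn hr
  have hw'c : ContinuousOn (fun q : ℝ × ℝ => deriv c.w (q.1 * f q.2)) (Ioo (-δ) δ ×ˢ Icc 0 T) :=
    (c.contDiffOn_w.continuousOn_deriv_of_isOpen isOpen_Ioo le_rfl).comp hσ.continuousOn hr
  have huc' : ContinuousOn (fun q : ℝ × ℝ => u q.2) (Ioo (-δ) δ ×ˢ Icc 0 T) :=
    huc.comp continuousOn_snd hsnd
  have hderiv : ∀ q ∈ Ioo (-δ) δ ×ˢ Icc 0 T, HasDerivAt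
      (fun ε => c.A (ε * f q.2) (u q.2) + (ε * f' q.2) • c.w (ε * f q.2))
      (f q.2 • deriv c.A (q.1 * f q.2) (u q.2) +
        (f' q.2 • c.w (q.1 * f q.2) + (q.1 * f' q.2 * f q.2) • deriv c.w (q.1 * f q.2))) q.1 := by
    intro q hq
    have hmem := isOpen_Ioo.mem_nhds (hr q hq)
    have hA := ((c.contDiffOn_A.differentiableOn (by simp)).differentiableAt hmem).hasDerivAt
    have hw := ((c.contDiffOn_w.differentiableOn (by simp)).differentiableAt hmem).hasDerivAt
    have h1 : HasDerivAt (fun ε => ε * f q.2) (f q.2) q.1 := by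
      simpa using (hasDerivAt_id q.1).mul_const (f q.2)
    have h2 : HasDerivAt (fun ε => ε * f' q.2) (f' q.2) q.1 := by
      simpa using (hasDerivAt_id q.1).mul_const (f' q.2)
    have hA₁ : HasDerivAt (fun ε => c.A (ε * f q.2)) (f q.2 • deriv c.A (q.1 * f q.2)) q.1 :=
      HasDerivAt.scomp (g₁ := c.A) (h := fun ε => ε * f q.2) q.1 hA h1
    have hw₁ : HasDerivAt (fun ε => c.w (ε * f q.2)) (f q.2 • deriv c.w (q.1 * f q.2)) q.1 :=
      HasDerivAt.scomp (g₁ := c.w) (h := fun ε => ε * f q.2) q.1 hw h1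
    have h3 := hA₁.clm_apply (hasDerivAt_const q.1 (u q.2))
    have h4 := h2.fun_smul hw₁
    refine (h3.fun_add h4).congr_deriv ?_
    rw [map_zero, add_zero, smul_smul, add_comm ((q.1 * f' q.2 * f q.2) • _)]
    rfl
  have hcont : ContinuousOn (fun q : ℝ × ℝ => f q.2 • deriv c.A (q.1 * f q.2) (u q.2) +
        (f' q.2 • c.w (q.1 * f q.2) + (q.1 * f' q.2 * f q.2) • deriv c.w (q.1 * f q.2)))
      (Ioo (-δ) δ ×ˢ Icc 0 T) := by
    refine ContinuousOn.add ?_ (ContinuousOn.add ?_ ?_)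
    · exact (hfc.comp continuous_snd).continuousOn.smul (hA'c.clm_apply huc')
    · exact (hf'.comp continuous_snd).continuousOn.smul hwc
    · exact ContinuousOn.smul (by fun_prop) hw'c
  refine ⟨?_, hderiv, hcont⟩
  constructor
  · intro t _
    simp [c.c_zero]
  · intro ε _
    simp [hf0, c.c_zero]
  · intro ε _
    simp [hfT, c.c_zero]
  · have h1 : ContMDiffOn 𝓘(ℝ, ℝ × ℝ) I 1 (fun q : ℝ × ℝ => g q.2) (Ioo (-δ) δ ×ˢ Icc 0 T) :=
      hg.comp contDiff_snd.contMDiff.contMDiffOn hsnd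
    have h2 : ContMDiffOn 𝓘(ℝ, ℝ × ℝ) I 1 (fun q : ℝ × ℝ => c.c (q.1 * f q.2))
        (Ioo (-δ) δ ×ˢ Icc 0 T) :=
      c.contMDiffOn_c.comp
        (contDiff_fst.mul (hf1.comp contDiff_snd)).contMDiff.contMDiffOn hr
    have : ContMDiffMul I 1 G := ContMDiffMul.of_le (n := ∞) (by simp)
    exact h1.mul h2
  · intro ε hε t ht
    exact hc g (u t) (Icc 0 T) t (fun τ => ε * f τ) (ε * f' t) ht (hr (ε, t) ⟨hε, ht⟩)
      ((hf t).const_mul ε).hasDerivWithinAt (hu t ht)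
  · exact (hAc.clm_apply huc').add (ContinuousOn.smul (by fun_prop) hwc)
  · intro ε hε t ht
    exact (hderiv (ε, t) ⟨hε, ht⟩).differentiableAt
  · exact hcont.congr fun q hq => (hderiv q hq).deriv

namespace Problem

variable [FiniteDimensional ℝ E] (P : Problem I G X) {g : ℝ → G} {u : ℝ → E}
  {l : ℝ → StrongDual ℝ P.𝔭}

theorem IsNormalExtremal.continuousOn_advected (hext : P.IsNormalExtremal g u l) :
    ContinuousOn (P.advected g) (Icc 0 P.T) := fun t ht =>
  (P.hasDerivWithinAt_advected (hext.velocity t ht)).continuousWithinAt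

variable [I.Boundaryless]

theorem IsNormalExtremal.continuousOn_control (hext : P.IsNormalExtremal g u l) :
    ContinuousOn u (Icc 0 P.T) :=
  have : CompleteSpace E := FiniteDimensional.complete ℝ E
  continuousOn_of_hasLeftVelocityWithinAt (uniqueDiffOn_Icc P.T_pos) hext.contMDiffOn hext.velocity

theorem IsNormalExtremal.continuousOn_momentum (hext : P.IsNormalExtremal g u l) :
    ContinuousOn (P.momentum u l) (Icc 0 P.T) := by
  have h1 : Continuous (fun x => fderiv ℝ (fun w : P.𝔨 => P.C (1, w)) x) :=
    P.contDiff_C.continuous_fderiv (by simp)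
  have h2 : ContinuousOn (fun t => P.projK (u t - P.e₀)) (Icc 0 P.T) :=
    P.projK.continuous.comp_continuousOn (hext.continuousOn_control.sub continuousOn_const)
  have h3 := (h1.comp_continuousOn h2).clm_comp (continuousOn_const (c := P.projK))
  have h4 := hext.multiplier.continuousOn.clm_comp (continuousOn_const (c := P.projP))
  exact h3.add h4

/-- The first variation of the action under the variations `g t * c (ε f t)`. -/
theorem IsNormalExtremal.integral_eq_zero (hext : P.IsNormalExtremal g u l) (v : E)
    {f f' : ℝ → ℝ} (hf' : Continuous f') (hf : ∀ t, HasDerivAt f (f' t) t)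
    (hf0 : f 0 = 0) (hfT : f P.T = 0) :
    ∫ t in (0 : ℝ)..P.T, (f' t * P.momentum u l t v + f t * (P.momentum u l t (ad I G (u t) v) +
      fderiv ℝ (fun β => P.Vext (1, β)) (P.advected g t)
        ((P.advected g t).comp (rhoPrime I P.ρ v)))) = 0 := by
  obtain ⟨c, hcA, hc⟩ := exists_translationCurve (I := I) (G := G) v
  have hfc : Continuous f := continuous_iff_continuousAt.2 fun t => (hf t).continuousAt
  obtain ⟨M, hM⟩ := (isCompact_Icc (a := (0 : ℝ)) (b := P.T)).exists_bound_of_continuousOn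
    hfc.continuousOn
  have hMpos : 0 < |M| + 1 := by positivity
  set δ : ℝ := c.r / (|M| + 1)
  have hδ : 0 < δ := div_pos c.r_pos hMpos
  have hr : ∀ q ∈ Ioo (-δ) δ ×ˢ Icc 0 P.T, q.1 * f q.2 ∈ Ioo (-c.r) c.r := by
    rintro ⟨ε, t⟩ ⟨hε, ht⟩
    refine abs_lt.1 ?_
    have h1 : |f t| ≤ |M| + 1 := ((hM t ht).trans (le_abs_self M)).trans (by linarith)
    have h2 : |ε| < δ := abs_lt.2 hε
    calc |ε * f t| = |ε| * |f t| := abs_mul _ _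
      _ ≤ |ε| * (|M| + 1) := by gcongr
      _ < δ * (|M| + 1) := by gcongr
      _ = c.r := div_mul_cancel₀ _ hMpos.ne'
  obtain ⟨hvar, hξ, hξc⟩ := isVariation_mul hext.contMDiffOn hext.velocity
    hext.continuousOn_control c hc hf' hf hf0 hfT hr
  have hstat := hext.stationary δ _ _ hδ hvar
  simp only [P.augLagrangian_eq] at hstat
  set ξ : ℝ → ℝ → E := fun ε t => c.A (ε * f t) (u t) + (ε * f' t) • c.w (ε * f t) with hξdef
  set ξ' : ℝ → ℝ → E := fun ε t => f t • deriv c.A (ε * f t) (u t) +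
        (f' t • c.w (ε * f t) + (ε * f' t * f t) • deriv c.w (ε * f t)) with hξ'def
  set α : ℝ → StrongDual ℝ X := P.advected g with hα
  set R : ℝ → X →L[ℝ] X := fun s => P.ρ (c.c s) with hR
  set C₀ : P.𝔨 → ℝ := fun w => P.C (1, w) with hC₀
  set U : StrongDual ℝ X → ℝ := fun β => P.Vext (1, β) with hU
  have hRd : ContDiffOn ℝ 1 R (Ioo (-c.r) c.r) := c.contDiffOn_representation P.ρ P.ρ_contMDiff
  have hC₀d (w : P.𝔨) : HasFDerivAt C₀ (fderiv ℝ C₀ w) w :=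
    ((P.contDiff_C.differentiable (by simp)) w).hasFDerivAt
  have hUd (β : StrongDual ℝ X) : HasFDerivAt U (fderiv ℝ U β) β :=
    ((P.contDiff_Vext.differentiable (by simp)) β).hasFDerivAt
  have hC₀c : Continuous (fderiv ℝ C₀) := P.contDiff_C.continuous_fderiv (by simp)
  have hUc : Continuous (fderiv ℝ U) := P.contDiff_Vext.continuous_fderiv (by simp)
  have hσ : Continuous fun q : ℝ × ℝ => q.1 * f q.2 := by fun_prop
  have hsnd : MapsTo (Prod.snd : ℝ × ℝ → ℝ) (Ioo (-δ) δ ×ˢ Icc 0 P.T) (Icc 0 P.T) :=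
    fun q hq => hq.2
  have hξc0 : ContinuousOn (fun q : ℝ × ℝ => ξ q.1 q.2) (Ioo (-δ) δ ×ˢ Icc 0 P.T) :=
    hvar.continuousOn
  have hprojc : ContinuousOn (fun q : ℝ × ℝ => P.projK (ξ q.1 q.2 - P.e₀))
      (Ioo (-δ) δ ×ˢ Icc 0 P.T) :=
    P.projK.continuous.comp_continuousOn (hξc0.sub continuousOn_const)
  have hαc : ContinuousOn (fun q : ℝ × ℝ => α q.2) (Ioo (-δ) δ ×ˢ Icc 0 P.T) :=
    hext.continuousOn_advected.comp continuousOn_snd hsnd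
  have hRc : ContinuousOn (fun q : ℝ × ℝ => R (q.1 * f q.2)) (Ioo (-δ) δ ×ˢ Icc 0 P.T) :=
    hRd.continuousOn.comp hσ.continuousOn hr
  have hR'c : ContinuousOn (fun q : ℝ × ℝ => deriv R (q.1 * f q.2)) (Ioo (-δ) δ ×ˢ Icc 0 P.T) :=
    (hRd.continuousOn_deriv_of_isOpen isOpen_Ioo le_rfl).comp hσ.continuousOn hr
  have hlc : ContinuousOn (fun q : ℝ × ℝ => P.inclP (l q.2)) (Ioo (-δ) δ ×ˢ Icc 0 P.T) :=
    (hext.multiplier.continuousOn.comp continuousOn_snd hsnd).clm_comp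
      (continuousOn_const (c := P.projP))
  have hint := hasDerivAt_integral_of_continuousOn hδ P.T_pos.le
    (F := fun ε t => C₀ (P.projK (ξ ε t - P.e₀)) + U ((α t).comp (R (ε * f t))) +
      P.inclP (l t) (ξ ε t - P.e₀))
    (F' := fun ε t => fderiv ℝ C₀ (P.projK (ξ ε t - P.e₀)) (P.projK (ξ' ε t)) +
      fderiv ℝ U ((α t).comp (R (ε * f t))) (f t • (α t).comp (deriv R (ε * f t))) +
      P.inclP (l t) (ξ' ε t)) ?_ ?_ ?_
  · have hzero := hint.unique hstat
    refine Eq.trans ?_ hzero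
    refine intervalIntegral.integral_congr fun t ht => ?_
    have hR0 : R 0 = ContinuousLinearMap.id ℝ X := by
      simp only [hR, c.c_zero, map_one]
      rfl
    have hR'0 : deriv R 0 = rhoPrime I P.ρ v :=
      (c.hasDerivAt_representation P.ρ P.ρ_contMDiff).deriv
    simp only [hξdef, hξ'def, zero_mul, c.A_zero, c.w_zero, hcA, hR0, hR'0, zero_smul, add_zero,
      ContinuousLinearMap.id_apply, ContinuousLinearMap.comp_id, map_add, map_smul, smul_eq_mul,
      momentum, dCost, add_apply, ContinuousLinearMap.comp_apply]
    ring
  · exact ((P.contDiff_C.continuous.comp_continuousOn hprojc).add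
      (P.contDiff_Vext.continuous.comp_continuousOn (hαc.clm_comp hRc))).add
      (hlc.clm_apply (hξc0.sub continuousOn_const))
  · refine ContinuousOn.add (ContinuousOn.add ?_ ?_) (hlc.clm_apply hξc)
    · exact (hC₀c.comp_continuousOn hprojc).clm_apply (P.projK.continuous.comp_continuousOn hξc)
    · exact (hUc.comp_continuousOn (hαc.clm_comp hRc)).clm_apply
        ((hfc.comp continuous_snd).continuousOn.smul (hαc.clm_comp hR'c))
  · intro ε hε t ht
    have h1 : HasDerivAt (fun ε => ξ ε t - P.e₀) (ξ' ε t) ε :=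
      (hξ (ε, t) ⟨hε, ht⟩).sub_const P.e₀
    have h2 : HasDerivAt (fun ε => P.projK (ξ ε t - P.e₀)) (P.projK (ξ' ε t)) ε :=
      P.projK.hasFDerivAt.comp_hasDerivAt ε h1
    have h3 : HasDerivAt (fun ε => ε * f t) (f t) ε := by
      simpa using (hasDerivAt_id ε).mul_const (f t)
    have h4 : HasDerivAt R (deriv R (ε * f t)) (ε * f t) :=
      ((hRd.differentiableOn (by simp)).differentiableAt
        (isOpen_Ioo.mem_nhds (hr (ε, t) ⟨hε, ht⟩))).hasDerivAt
    have h5 : HasDerivAt (fun ε => (α t).comp (R (ε * f t)))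
        (f t • (α t).comp (deriv R (ε * f t))) ε := by
      have h := ((ContinuousLinearMap.compL ℝ X X ℝ (α t)).hasFDerivAt).comp_hasDerivAt ε
        (HasDerivAt.scomp ε h4 h3)
      rw [map_smul] at h
      exact h
    exact (((hC₀d _).comp_hasDerivAt ε h2).add ((hUd _).comp_hasDerivAt ε h5)).add
      ((P.inclP (l t)).hasFDerivAt.comp_hasDerivAt ε h1)

end Problem

/-- A curve in the dual of a finite-dimensional space is differentiable if it is so pointwise. -/
theorem hasDerivWithinAt_strongDual [FiniteDimensional ℝ E] {μ : ℝ → StrongDual ℝ E}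
    {μ' : StrongDual ℝ E} {s : Set ℝ} {t : ℝ} (h : ∀ v, HasDerivWithinAt (fun τ => μ τ v) (μ' v) s t) :
    HasDerivWithinAt μ μ' s t := by
  set b := Module.finBasis ℝ E
  have hb (ν : StrongDual ℝ E) : ν = ∑ i, ν (b i) • LinearMap.toContinuousLinearMap (b.coord i) := by
    ext x
    calc ν x = ν (∑ i, b.repr x i • b i) := by rw [b.sum_repr]
      _ = ∑ i, b.repr x i • ν (b i) := by simp only [map_sum, map_smul]
      _ = _ := by simp [mul_comm, -map_sum]
  have h1 := HasDerivWithinAt.fun_sum (u := Finset.univ) fun i _ =>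
    (h (b i)).smul_const (LinearMap.toContinuousLinearMap (b.coord i))
  rw [← hb μ'] at h1
  rw [funext fun τ => hb (μ τ)]
  exact h1

end BrokenSymmetryOCP

theorem theorem4
    {E : Type*} [NormedAddCommGroup E] [NormedSpace ℝ E] [FiniteDimensional ℝ E]
    {H : Type*} [TopologicalSpace H] {I : ModelWithCorners ℝ E H} [I.Boundaryless]
    {G : Type*} [TopologicalSpace G] [ChartedSpace H G] [Group G] [LieGroup I ∞ G]
    {X : Type*} [NormedAddCommGroup X] [NormedSpace ℝ X] [FiniteDimensional ℝ X]
    (P : BrokenSymmetryOCP.Problem I G X)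
    (g : ℝ → G) (u : ℝ → E) (l : ℝ → StrongDual ℝ P.𝔭)
    (hext : P.IsNormalExtremal g u l) :
    (∀ t ∈ Set.Icc 0 P.T,
      HasDerivWithinAt (P.momentum u l)
        (BrokenSymmetryOCP.adStar I G (u t) (P.momentum u l t) +
          BrokenSymmetryOCP.momentumMap I P.ρ (P.dPotential (P.advected g t)) (P.advected g t))
        (Set.Icc 0 P.T) t) ∧
    (∀ t ∈ Set.Icc 0 P.T,
      HasDerivWithinAt (P.advected g)
        (BrokenSymmetryOCP.rhoPrimeStar I P.ρ (u t) (P.advected g t))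
        (Set.Icc 0 P.T) t) ∧
    P.advected g 0 = BrokenSymmetryOCP.rhoStar P.ρ P.g₀ P.α₀ := by
  refine ⟨fun t ht => ?_, fun t ht => P.hasDerivWithinAt_advected (hext.velocity t ht), ?_⟩
  · refine BrokenSymmetryOCP.hasDerivWithinAt_strongDual fun v => ?_
    have hm := hext.continuousOn_momentum
    have hα := hext.continuousOn_advected
    have hU : Continuous (fderiv ℝ fun β => P.Vext (1, β)) :=
      P.contDiff_Vext.continuous_fderiv (by simp)
    have had : ContinuousOn (fun t => BrokenSymmetryOCP.ad I G (u t) v) (Icc 0 P.T) := by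
      simp only [BrokenSymmetryOCP.ad_apply]
      exact ((continuousOn_const.clm_apply hext.continuousOn_control).clm_apply
        continuousOn_const).sub (continuousOn_const.clm_apply hext.continuousOn_control)
    have h := BrokenSymmetryOCP.hasDerivWithinAt_of_forall_integral_eq_zero P.T_pos
      (hm.clm_apply (continuousOn_const (c := v)))
      ((hm.clm_apply had).add ((hU.comp_continuousOn hα).clm_apply
        (hα.clm_comp (continuousOn_const (c := BrokenSymmetryOCP.rhoPrime I P.ρ v)))))
      (fun f f' hf' hf hf0 hfT => hext.integral_eq_zero P v hf' hf hf0 hfT) t ht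
    convert! h using 1
    have hJ := BrokenSymmetryOCP.apply_dualGradient (fun β => P.Vext (1, β)) (P.advected g t)
      ((P.advected g t).comp (BrokenSymmetryOCP.rhoPrime I P.ρ v))
    exact congrArg (fun z => P.momentum u l t (BrokenSymmetryOCP.ad I G (u t) v) + z) hJ
  · rw [BrokenSymmetryOCP.Problem.advected, hext.left_end]
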